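/- Let $V_1=\mathbb{R}^5$ with basis $m_0,\dots,m_4$, $V_2=\mathbb{R}^3$ with basis $l_0,l_1,l_2$, and $V=\wedge^2V_1\otimes V_2$ with the natural action of $G_{\mathbb R}=\mathrm{GL}(5)_{\mathbb R}\times\mathrm{GL}(3)_{\mathbb R}$. Let $H_{\mathbb R}=\mathrm{SL}(5)_{\mathbb R}\times\mathrm{SL}(3)_{\mathbb R}\subset G_{\mathbb R}$, with its classical topology, and let $$w=(m_1\wedge m_4-3m_2\wedge m_3)\otimes l_0+(-m_0\wedge m_4+2m_1\wedge m_3)\otimes l_1+(m_0\wedge m_3-3m_1\wedge m_2)\otimes l_2 .$$ For $x=\sum_{i<j} m_i\wedge m_j\otimes x_{ij}\in V$ (with $x_{ij}\in V_2$) let $\mathrm{Pfaff}_i(x)\in\mathrm{Sym}^2V_2$ ($0\le i\le 4$) be $(-1)^i$ times the Pfaffian $x_{ab}x_{cd}-x_{ac}x_{bd}+x_{ad}x_{bc}$, where $a<b<c<d$ are the elements of $\{0,\dots,4\}\setminus\{i\}$. Regard $\mathrm{Sym}^2V_2$ as the space of symmetric $3\times3$ matrices, $uv$ being $\frac12(u\,{}^tv+v\,{}^tu)$,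 and put $\phi_1(x)(a)=\sum_i a_i\,\mathrm{Pfaff}_i(x)$ for $a=\sum_i a_im_i\in V_1$. Let $\Phi_1(x)$ be the symmetric $3\times 3$ matrix whose $(s,t)$-entry is the coefficient of $l_0^2\wedge l_1^2\wedge l_2^2\wedge l_0l_1\wedge l_1l_2\wedge l_0l_2$ in $3^{-4}\,(l_sl_t)\wedge \mathrm{Pfaff}_0(x)\wedge\cdots\wedge\mathrm{Pfaff}_4(x)\in\wedge^6\,\mathrm{Sym}^2V_2$. Let $\Phi_2(x)$ be the quadratic form $a\mapsto\mathrm{tr}\big((\phi_1(x)(a)\,\Phi_1(x))^2\big)$ on $V_1$. Let $H_{x\mathbb R}$ be the stabilizer of $x$ in $H_{\mathbb R}$, let $H_{x1\mathbb R}\subset\mathrm{SL}(5)_{\mathbb R}$ and $H_{x2\mathbb R}\subset\mathrm{SL}(3)_{\mathbb R}$ be its projections to the two factors, and let $H_{x3\mathbb R}=\mathrm{SO}(\Phi_2(x))_{\mathbb R}=\{g\in\mathrm{SL}(5)_{\mathbb R}\mid \Phi_2(x)(ga)=\Phi_2(x)(a)\ \text{for all } a\in V_1\}$. For a closed subgroup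 $K$ write $K^0$ for its connected component of $1$ in the classical topology. **Proposition.** Let $x\in G_{\mathbb R}w$. (1) Every closed connected subgroup $F$ with $H_{x\mathbb R}^0\subset F\subset H_{\mathbb R}$ is one of the seven groups $$H_{x\mathbb R}^0,\quad H_{x1\mathbb R}^0\times H_{x2\mathbb R}^0,\quad H_{x1\mathbb R}^0\times\mathrm{SL}(3)_{\mathbb R},\quad H_{x3\mathbb R}^0\times H_{x2\mathbb R}^0,\quad H_{x3\mathbb R}^0\times\mathrm{SL}(3)_{\mathbb R},\quad \mathrm{SL}(5)_{\mathbb R}\times H_{x2\mathbb R}^0,\quad \mathrm{SL}(5)_{\mathbb R}\times\mathrm{SL}(3)_{\mathbb R}.$$ (2) Every closed connected subgroup $F$ with $H_{x\mathbb R}\subset F\subset H_{\mathbb R}$ is one of the seven groups $$H_{x\mathbb R},\quad H_{x1\mathbb R}\times H_{x2\mathbb R},\quad H_{x1\mathbb R}\times\mathrm{SL}(3)_{\mathbb R},\quad H_{x3\mathbb R}\times H_{x2\mathbb R},\quad H_{x3\mathbb R}\times\mathrm{SL}(3)_{\mathbb R},\quad \mathrm{SL}(5)_{\mathbb R}\times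 H_{x2\mathbb R},\quad \mathrm{SL}(5)_{\mathbb R}\times\mathrm{SL}(3)_{\mathbb R}.$$ -/

import Mathlib

open Matrix

/-- `V = ∧² V₁ ⊗ V₂` with `V₁ = ℝ⁵` (basis `m₀, …, m₄`) and `V₂ = ℝ³` (basis `l₀, l₁, l₂`).
An element `x₀ ⊗ l₀ + x₁ ⊗ l₁ + x₂ ⊗ l₂` is the triple of `xₖ ∈ ∧² V₁`, and `∧² V₁` is the space of
alternating `5 × 5` matrices, `mᵢ ∧ mⱼ` being the matrix `Eᵢⱼ - Eⱼᵢ`. -/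
def altTensor : Submodule ℝ (Fin 3 → Matrix (Fin 5) (Fin 5) ℝ) where
  carrier := {x | ∀ k, (x k)ᵀ = -x k}
  add_mem' := by
    intro a b ha hb k
    simp only [Pi.add_apply, transpose_add, ha k, hb k, neg_add]
  zero_mem' := by
    intro k
    simp
  smul_mem' := by
    intro c a ha k
    simp only [Pi.smul_apply, transpose_smul, ha k, smul_neg]

/-- `G_ℝ = GL(5)_ℝ × GL(3)_ℝ`. -/
abbrev GReal : Type := GL (Fin 5) ℝ × GL (Fin 3) ℝ

/-- `H_ℝ = SL(5)_ℝ × SL(3)_ℝ`, with the classical topology. -/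
abbrev HReal : Type := SpecialLinearGroup (Fin 5) ℝ × SpecialLinearGroup (Fin 3) ℝ

/-- The natural action of `G_ℝ` on `∧² V₁ ⊗ V₂`: the element `g₁` sends `A ∈ ∧² V₁` to `g₁ A g₁ᵀ`,
and `g₂` sends `lⱼ` to `∑ₖ (g₂)ₖⱼ lₖ`. -/
instance altTensorAction : MulAction GReal altTensor where
  smul g x := ⟨fun k => ∑ j, (g.2 : Matrix (Fin 3) (Fin 3) ℝ) k j •
      ((g.1 : Matrix (Fin 5) (Fin 5) ℝ) * x.1 j * (g.1 : Matrix (Fin 5) (Fin 5) ℝ)ᵀ), by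
    intro k
    simp only [transpose_sum, transpose_smul, transpose_mul, transpose_transpose, x.2 _,
      Matrix.mul_neg, Matrix.neg_mul, smul_neg, Finset.sum_neg_distrib, Matrix.mul_assoc]⟩
  one_smul x := by
    apply Subtype.ext
    funext k
    change ∑ j, (1 : Matrix (Fin 3) (Fin 3) ℝ) k j •
      ((1 : Matrix (Fin 5) (Fin 5) ℝ) * x.1 j * (1 : Matrix (Fin 5) (Fin 5) ℝ)ᵀ) = x.1 k
    simp [Matrix.one_apply]
  mul_smul g h x := by
    apply Subtype.ext
    funext k
    change ∑ j, ((g.2 : Matrix (Fin 3) (Fin 3) ℝ) * (h.2 : Matrix (Fin 3) (Fin 3) ℝ)) k j •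
        (((g.1 : Matrix (Fin 5) (Fin 5) ℝ) * (h.1 : Matrix (Fin 5) (Fin 5) ℝ)) * x.1 j *
          ((g.1 : Matrix (Fin 5) (Fin 5) ℝ) * (h.1 : Matrix (Fin 5) (Fin 5) ℝ))ᵀ) =
      ∑ i, (g.2 : Matrix (Fin 3) (Fin 3) ℝ) k i • ((g.1 : Matrix (Fin 5) (Fin 5) ℝ) *
        (∑ j, (h.2 : Matrix (Fin 3) (Fin 3) ℝ) i j •
          ((h.1 : Matrix (Fin 5) (Fin 5) ℝ) * x.1 j * (h.1 : Matrix (Fin 5) (Fin 5) ℝ)ᵀ)) *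
        (g.1 : Matrix (Fin 5) (Fin 5) ℝ)ᵀ)
    simp only [Matrix.mul_apply (M := (g.2 : Matrix (Fin 3) (Fin 3) ℝ)), Finset.sum_smul,
      Matrix.mul_sum, Matrix.sum_mul, Finset.smul_sum, Matrix.mul_smul, Matrix.smul_mul,
      smul_smul, transpose_mul, Matrix.mul_assoc]
    exact Finset.sum_comm

/-- `mᵢ ∧ mⱼ`. -/
def wedge (i j : Fin 5) : Matrix (Fin 5) (Fin 5) ℝ :=
  Matrix.single i j 1 - Matrix.single j i 1

/-- The base point
`w = (m₁∧m₄ - 3 m₂∧m₃) ⊗ l₀ + (-m₀∧m₄ + 2 m₁∧m₃) ⊗ l₁ + (m₀∧m₃ - 3 m₁∧m₂) ⊗ l₂`. -/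
def basePoint : altTensor :=
  ⟨![wedge 1 4 - (3 : ℝ) • wedge 2 3,
     -wedge 0 4 + (2 : ℝ) • wedge 1 3,
     wedge 0 3 - (3 : ℝ) • wedge 1 2], by
    intro k
    fin_cases k <;> simp [wedge, transpose_sub, transpose_add, transpose_smul] <;>
      module⟩

/-- The inclusion `H_ℝ → G_ℝ`. -/
def inclHG : HReal →* GReal :=
  MonoidHom.prodMap SpecialLinearGroup.toGL SpecialLinearGroup.toGL

/-- The stabilizer `H_{xℝ}` of `x` in `H_ℝ`. -/
def stabH (x : altTensor) : Subgroup HReal :=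
  (MulAction.stabilizer GReal x).comap inclHG

/-- `H_{x1}`, the projection of `H_x` to the first factor. -/
def stabH1 (x : altTensor) : Subgroup (SpecialLinearGroup (Fin 5) ℝ) :=
  (stabH x).map (MonoidHom.fst _ _)

/-- `H_{x2}`, the projection of `H_x` to the second factor. -/
def stabH2 (x : altTensor) : Subgroup (SpecialLinearGroup (Fin 3) ℝ) :=
  (stabH x).map (MonoidHom.snd _ _)

section EquivariantMaps

/-- The coefficient `x_{ij} ∈ V₂` in `x = ∑_{i<j} mᵢ ∧ mⱼ ⊗ x_{ij}`. -/
def coeffV2 (x : altTensor) (i j : Fin 5) : Fin 3 → ℝ := fun k => x.1 k i j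

/-- The product `a b ∈ Sym² V₂ ⊆ V₂ ⊗ V₂` of `a, b ∈ V₂`, as a symmetric matrix:
`a b = (a ⊗ b + b ⊗ a) / 2`. -/
noncomputable def symProd (a b : Fin 3 → ℝ) : Matrix (Fin 3) (Fin 3) ℝ :=
  (1 / 2 : ℝ) • (Matrix.vecMulVec a b + Matrix.vecMulVec b a)

/-- For four indices, the `4 × 4` Pfaffian `x_{ij} x_{kl} - x_{ik} x_{jl} + x_{il} x_{jk}`,
with values in `Sym² V₂`. -/
noncomputable def pfaffMinor (x : altTensor) (i j k l : Fin 5) : Matrix (Fin 3) (Fin 3) ℝ :=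
  symProd (coeffV2 x i j) (coeffV2 x k l) - symProd (coeffV2 x i k) (coeffV2 x j l)
    + symProd (coeffV2 x i l) (coeffV2 x j k)

/-- The five signed Pfaffians `Pfaff₀(x), …, Pfaff₄(x) ∈ Sym² V₂`. -/
noncomputable def pfaff (x : altTensor) : Fin 5 → Matrix (Fin 3) (Fin 3) ℝ :=
  ![pfaffMinor x 1 2 3 4, -pfaffMinor x 0 2 3 4, pfaffMinor x 0 1 3 4,
    -pfaffMinor x 0 1 2 4, pfaffMinor x 0 1 2 3]

/-- `φ₁(x) = ∑ᵢ mᵢ* ⊗ Pfaffᵢ(x) ∈ V₁* ⊗ Sym² V₂`, as a linear map `V₁ → Sym² V₂`. -/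
noncomputable def phi1 (x : altTensor) : (Fin 5 → ℝ) →ₗ[ℝ] Matrix (Fin 3) (Fin 3) ℝ :=
  ∑ i, (LinearMap.proj i : (Fin 5 → ℝ) →ₗ[ℝ] ℝ).smulRight (pfaff x i)

/-- Coordinates of an element of `Sym² V₂` (a symmetric matrix) with respect to the basis
`l₀², l₁², l₂², l₀l₁, l₁l₂, l₀l₂`. -/
def symCoords (q : Matrix (Fin 3) (Fin 3) ℝ) : Fin 6 → ℝ :=
  ![q 0 0, q 1 1, q 2 2, 2 * q 0 1, 2 * q 1 2, 2 * q 0 2]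

/-- `Φ₁(x) = 3⁻⁴ Pfaff₀(x) ∧ ⋯ ∧ Pfaff₄(x) ∈ ∧⁵ Sym² V₂ ≅ (Sym² V₂)* = Sym² V₂*`, the
isomorphism being given by `q ∧ -` and the volume element of the basis used in `symCoords`.
This is the Gram matrix of the corresponding symmetric bilinear form on `V₂`: the entry `(s, t)` is
the value of the functional at `q = l_s l_t`. -/
noncomputable def Phi1 (x : altTensor) : Matrix (Fin 3) (Fin 3) ℝ :=
  Matrix.of fun s t => (1 / 3 ^ 4 : ℝ) *
    Matrix.det (Matrix.of ![symCoords (symProd (Pi.single s 1) (Pi.single t 1)),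
      symCoords (pfaff x 0), symCoords (pfaff x 1), symCoords (pfaff x 2),
      symCoords (pfaff x 3), symCoords (pfaff x 4)])

/-- `φ₃(x) = φ₁(x) Φ₁(x)`, a `3 × 3` matrix with entries in `V₁*`, viewed as a linear map from
`V₁` to real `3 × 3` matrices. -/
noncomputable def phi3 (x : altTensor) : (Fin 5 → ℝ) →ₗ[ℝ] Matrix (Fin 3) (Fin 3) ℝ :=
  (LinearMap.mulRight ℝ (Phi1 x)).comp (phi1 x)

/-- The quadratic form `Φ₂(x) = tr (φ₃(x)²) ∈ Sym² V₁*`. -/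
noncomputable def Phi2 (x : altTensor) : QuadraticForm ℝ (Fin 5 → ℝ) :=
  LinearMap.BilinMap.toQuadraticMap
    (LinearMap.mk₂ ℝ (fun a b => Matrix.trace (phi3 x a * phi3 x b))
      (by intros; simp [add_mul]) (by intros; simp)
      (by intros; simp [mul_add]) (by intros; simp))

end EquivariantMaps

/-- The special orthogonal group of a quadratic form on `ℝⁿ`. -/
def specialOrthogonal {n : ℕ} (Q : QuadraticForm ℝ (Fin n → ℝ)) :
    Subgroup (SpecialLinearGroup (Fin n) ℝ) where
  carrier := {g | ∀ a, Q ((g : Matrix (Fin n) (Fin n) ℝ) *ᵥ a) = Q a}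
  one_mem' := by
    intro a
    simp
  mul_mem' := by
    intro g h hg hh a
    change Q (((g : Matrix (Fin n) (Fin n) ℝ) * (h : Matrix (Fin n) (Fin n) ℝ)) *ᵥ a) = Q a
    rw [← Matrix.mulVec_mulVec, hg, hh]
  inv_mem' := by
    intro g hg a
    have h : (g : Matrix (Fin n) (Fin n) ℝ) * ((g⁻¹ : SpecialLinearGroup (Fin n) ℝ) :
        Matrix (Fin n) (Fin n) ℝ) = 1 :=
      congrArg Subtype.val (mul_inv_cancel g)
    rw [← hg, Matrix.mulVec_mulVec, h, Matrix.one_mulVec]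

/-- `H_{x3} = SO(Φ₂(x))`. -/
noncomputable def stabH3 (x : altTensor) : Subgroup (SpecialLinearGroup (Fin 5) ℝ) :=
  specialOrthogonal (Phi2 x)

/-- The connected component of `1` of a subgroup `K` of a topological group, in the topology
induced on `K`. -/
def idComp {A : Type*} [Group A] [TopologicalSpace A] [IsTopologicalGroup A] (K : Subgroup A) :
    Subgroup A :=
  (Subgroup.connectedComponentOfOne K).map K.subtype

/-!
A closed connected subgroup of a linear group is generated by the exponentials of its Lie algebra,
so the task is to find the Lie subalgebras of `𝔰𝔩₅ × 𝔰𝔩₃` containing the Lie algebra of the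
stabilizer of `w`, which is a diagonally embedded principal `sl₂` with raising operator
`(e₅, e₃)`. Under the principal `sl₂` the module `𝔤𝔩ₙ` is multiplicity-free with highest weight
vectors `eᵏ` of weight `2k`, and the Casimir operator separates the isotypic components. Hence an
intermediate subalgebra is determined by the combinations `(a e₅ᵏ, b e₃ᵏ)` it contains, and a few
explicit brackets show which of them can occur together; in the first factor the odd powers are
those lying in `𝔰𝔬(Φ₂)`. A subalgebra larger than the diagonal `sl₂` contains `(e₅, 0)`, and
therefore splits as a product.

If a connected subgroup contains the whole stabilizer of `w`, its first factor cannot be `SO(Φ₂)⁰`: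
the stabilizer has an element whose first component reverses the orientation of a maximal negative
definite plane of `Φ₂`. The other points of the orbit follow by conjugation, under which `Φ₂` only
changes by a linear substitution and a nonzero scalar.
-/

section IdentityComponent

open Filter Topology

variable {G : Type*} [Group G] [TopologicalSpace G] [IsTopologicalGroup G]

lemma idComp_le_of_eventually {K D : Subgroup G} (h : ∀ᶠ g in 𝓝 (1 : G), g ∈ K → g ∈ D) :
    idComp K ≤ D := by
  rintro _ ⟨g, hg, rfl⟩
  have hopen : IsOpen ((D.comap K.subtype : Subgroup K) : Set K) := by
    refine Subgroup.isOpen_of_mem_nhds _ (g := 1) ?_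
    have hval : Tendsto K.subtype (𝓝 1) (𝓝 1) := continuous_subtype_val.tendsto (1 : K)
    filter_upwards [hval.eventually h] with k hk using hk k.2
  have hclopen : IsClopen ((D.comap K.subtype : Subgroup K) : Set K) :=
    ⟨Subgroup.isClosed_of_isOpen _ hopen, hopen⟩
  exact hclopen.connectedComponent_subset (Subgroup.one_mem _) hg

lemma idComp_eq_self {F : Subgroup G} (hF : IsConnected (F : Set G)) : idComp F = F := by
  have : ConnectedSpace F := Subtype.connectedSpace hF
  refine le_antisymm (Subgroup.map_subtype_le _) fun g hg => ⟨⟨g, hg⟩, ?_, rfl⟩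
  change (⟨g, hg⟩ : F) ∈ connectedComponent (1 : F)
  simp [PreconnectedSpace.connectedComponent_eq_univ]

end IdentityComponent

section ClosedSubgroup

open NormedSpace Filter Topology

attribute [local instance 100] LieRing.ofAssociativeRing

/-- The subgroup generated by the `g` whose image under the representation `ι` is the exponential
of an element of `L`. For a Lie algebra `L` of a closed linear group this is the connected Lie
group with Lie algebra `L`. -/
def expGroup {A G : Type*} [NormedRing A] [Group G] (ι : G →* A) (L : Set A) : Subgroup G :=
  Subgroup.closure {g | ∃ X ∈ L, ι g = exp X}

lemma mem_expGroup {A G : Type*} [NormedRing A] [Group G] {ι : G →* A} {L : Set A}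
    {g : G} {X : A} (hX : X ∈ L) (h : ι g = exp X) : g ∈ expGroup ι L :=
  Subgroup.subset_closure ⟨X, hX, h⟩

lemma expGroup_le_iff {A G : Type*} [NormedRing A] [Group G] {ι : G →* A} {L : Set A}
    {D : Subgroup G} : expGroup ι L ≤ D ↔ ∀ g, ∀ X ∈ L, ι g = exp X → g ∈ D :=
  (Subgroup.closure_le D).trans
    ⟨fun h _ X hX hg => h ⟨X, hX, hg⟩, fun h g ⟨X, hX, hg⟩ => h g X hX hg⟩

variable {A : Type*} [NormedRing A] [NormedAlgebra ℝ A] [CompleteSpace A]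

lemma continuous_exp_of_real : Continuous (exp : A → A) := by
  let := NormedAlgebra.restrictScalars ℚ ℝ A
  exact exp_continuous

lemma exp_neg_mul_exp (X : A) : exp (-X) * exp X = 1 := by
  let := NormedAlgebra.restrictScalars ℚ ℝ A
  rw [← exp_add_of_commute (Commute.refl X).neg_left, neg_add_cancel, exp_zero]

lemma exp_natCast_smul (X : A) (n : ℕ) : exp ((n : ℝ) • X) = exp X ^ n := by
  let := NormedAlgebra.restrictScalars ℚ ℝ A
  rw [← NormedSpace.exp_nsmul, Nat.cast_smul_eq_nsmul]

lemma exp_conj_of_mul_eq_one {a b : A} (hab : a * b = 1) (hba : b * a = 1) (X : A) :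
    exp (a * X * b) = a * exp X * b := by
  let := NormedAlgebra.restrictScalars ℚ ℝ A
  exact exp_units_conj ⟨a, b, hab, hba⟩ X

lemma hasDerivAt_exp_smul_zero (X : A) : HasDerivAt (fun t : ℝ => exp (t • X)) X 0 := by
  simpa using hasDerivAt_exp_smul_const (𝕂 := ℝ) X 0

lemma exists_local_log : ∃ log : A → A, log 1 = 0 ∧ (∀ᶠ y in 𝓝 (1 : A), exp (log y) = y) ∧
    HasFDerivAt log (ContinuousLinearMap.id ℝ A) 1 := by
  have h : HasStrictFDerivAt (exp : A → A)
      ((ContinuousLinearEquiv.refl ℝ A : A ≃L[ℝ] A) : A →L[ℝ] A) 0 :=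
    hasStrictFDerivAt_exp_zero
  refine ⟨h.localInverse _ _ _, ?_, ?_, ?_⟩
  · simpa using h.localInverse_apply_image
  · simpa using h.eventually_right_inverse
  · simpa using h.to_localInverse.hasFDerivAt

lemma map_nhds_zero_exp_mul_exp [FiniteDimensional ℝ A] {L W : Submodule ℝ A}
    (h : Codisjoint L W) :
    map (fun p : L × W => exp (p.1 : A) * exp (p.2 : A)) (𝓝 0) = 𝓝 1 := by
  have hexp : HasStrictFDerivAt (exp : A → A) (1 : A →L[ℝ] A) 0 := hasStrictFDerivAt_exp_zero
  have hfst : HasStrictFDerivAt (fun p : L × W => exp (p.1 : A))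
      (L.subtypeL.comp (.fst ℝ L W)) 0 :=
    HasStrictFDerivAt.comp (g := exp) (g' := 1) 0 hexp
      (L.subtypeL.comp (.fst ℝ L W)).hasStrictFDerivAt
  have hsnd : HasStrictFDerivAt (fun p : L × W => exp (p.2 : A))
      (W.subtypeL.comp (.snd ℝ L W)) 0 :=
    HasStrictFDerivAt.comp (g := exp) (g' := 1) 0 hexp
      (W.subtypeL.comp (.snd ℝ L W)).hasStrictFDerivAt
  have hmul : HasStrictFDerivAt (fun p : L × W => exp (p.1 : A) * exp (p.2 : A))
      (L.subtypeL.coprod W.subtypeL) 0 :=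
    (hfst.mul' hsnd).congr_fderiv (by ext <;> simp)
  have hsurj : (L.subtypeL.coprod W.subtypeL).range = ⊤ := by
    rw [ContinuousLinearMap.range_coprod]
    simpa using h.eq_top
  simpa using hmul.map_nhds_eq_of_surj hsurj

variable {G : Type*} [Group G] (ι : G →* A)

/-- The tangent directions `X` of the one-parameter groups `t ↦ exp (t X)` inside `K`. -/
def lieSet (K : Subgroup G) : Set A := {X | ∀ t : ℝ, ∃ g ∈ K, ι g = exp (t • X)}

variable {ι} {K : Subgroup G}

lemma map_inv_eq_exp_neg {g : G} {Y : A} (h : ι g = exp Y) : ι g⁻¹ = exp (-Y) :=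
  (left_inv_eq_right_inv (h ▸ exp_neg_mul_exp Y) (map_mul_eq_one ι (mul_inv_cancel g))).symm

lemma exists_map_eq_exp_int_smul {Y : A} (h : ∃ g ∈ K, ι g = exp Y) (n : ℤ) :
    ∃ g ∈ K, ι g = exp ((n : ℝ) • Y) := by
  obtain ⟨g, hg, hgY⟩ := h
  refine ⟨g ^ n, K.zpow_mem hg n, ?_⟩
  obtain ⟨m, rfl | rfl⟩ := n.eq_nat_or_neg
  · rw [zpow_natCast, map_pow, hgY, ← exp_natCast_smul, Int.cast_natCast]
  · rw [_root_.zpow_neg, zpow_natCast, ← inv_pow, map_pow, map_inv_eq_exp_neg hgY,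
      ← exp_natCast_smul, smul_neg, Int.cast_neg, Int.cast_natCast, neg_smul]

-- `exp (t X)` is the limit of the powers `(exp (Y i)) ^ ⌊t r i⌋`, which lie in the closed set.
lemma mem_lieSet_of_tendsto (hK : IsClosed (ι '' (K : Set G))) {α : Type*} {l : Filter α} [l.NeBot]
    {Y : α → A} {r : α → ℝ} {X : A} (hYK : ∀ᶠ i in l, ∃ g ∈ K, ι g = exp (Y i))
    (hY : Tendsto Y l (𝓝 0)) (hr : Tendsto (fun i => r i • Y i) l (𝓝 X)) : X ∈ lieSet ι K := by
  intro t
  have hfract : Tendsto (fun i => Int.fract (t * r i) • Y i) l (𝓝 0) := by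
    refine squeeze_zero_norm (a := fun i => ‖Y i‖) (fun i => ?_) (by simpa using hY.norm)
    rw [norm_smul, Real.norm_of_nonneg (Int.fract_nonneg _)]
    exact mul_le_of_le_one_left (norm_nonneg _) (Int.fract_lt_one _).le
  have hfloor : Tendsto (fun i => (⌊t * r i⌋ : ℝ) • Y i) l (𝓝 (t • X)) := by
    have h := (hr.const_smul t).sub hfract
    rw [sub_zero] at h
    refine h.congr fun i => ?_
    rw [smul_smul, ← sub_smul, Int.self_sub_fract]
  have hexp := (continuous_exp_of_real.tendsto (t • X)).comp hfloor
  exact hK.mem_of_tendsto hexp (hYK.mono fun i hi => exists_map_eq_exp_int_smul hi _)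

lemma mem_lieSet_of_hasDerivAt (hK : IsClosed (ι '' (K : Set G))) {γ : ℝ → A} {X : A}
    (hγK : ∀ t, ∃ g ∈ K, ι g = γ t) (hγ : γ 0 = 1) (hd : HasDerivAt γ X 0) : X ∈ lieSet ι K := by
  obtain ⟨log, hlog_one, hexp_log, hlog_deriv⟩ := exists_local_log (A := A)
  have hd_log : HasDerivAt (fun t => log (γ t)) X 0 := by
    rw [← hγ] at hlog_deriv
    exact hlog_deriv.comp_hasDerivAt 0 hd
  have hγ_one : Tendsto γ (𝓝[≠] 0) (𝓝 1) := hγ ▸ hd.continuousAt.tendsto.mono_left inf_le_left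
  refine mem_lieSet_of_tendsto hK (l := 𝓝[≠] (0 : ℝ)) (Y := fun t => log (γ t))
    (r := fun t => t⁻¹) ?_ ?_ ?_
  · filter_upwards [hγ_one.eventually hexp_log] with t ht
    rw [ht]
    exact hγK t
  · have hlim := hd_log.continuousAt.tendsto.mono_left (nhdsWithin_le_nhds (s := {0}ᶜ))
    rwa [hγ, hlog_one] at hlim
  · refine (hasDerivAt_iff_tendsto_slope.1 hd_log).congr fun t => ?_
    simp [slope_def_module, hγ, hlog_one]

variable (ι K) in
/-- The Lie algebra of a closed linear group, as a vector space. -/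
def lieSubmodule (hK : IsClosed (ι '' (K : Set G))) : Submodule ℝ A where
  carrier := lieSet ι K
  zero_mem' := fun t => ⟨1, K.one_mem, by simp⟩
  smul_mem' := fun c X hX t => by simpa [smul_smul] using hX (t * c)
  add_mem' := by
    intro X Y hX hY
    refine mem_lieSet_of_hasDerivAt hK (γ := fun t => exp (t • X) * exp (t • Y)) (fun t => ?_)
      (by simp) ?_
    · obtain ⟨g, hg, hgX⟩ := hX t
      obtain ⟨h, hh, hhY⟩ := hY t
      exact ⟨g * h, K.mul_mem hg hh, by rw [map_mul, hgX, hhY]⟩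
    · simpa [Pi.mul_def] using (hasDerivAt_exp_smul_zero X).mul (hasDerivAt_exp_smul_zero Y)

lemma conj_mem_lieSet {g : G} (hg : g ∈ K) {X : A} (hX : X ∈ lieSet ι K) :
    ι g * X * ι g⁻¹ ∈ lieSet ι K := by
  intro t
  obtain ⟨h, hh, hhX⟩ := hX t
  refine ⟨g * h * g⁻¹, K.mul_mem (K.mul_mem hg hh) (K.inv_mem hg), ?_⟩
  rw [map_mul, map_mul, hhX, ← exp_conj_of_mul_eq_one (map_mul_eq_one ι (mul_inv_cancel g))
    (map_mul_eq_one ι (inv_mul_cancel g)),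
    mul_smul_comm, smul_mul_assoc]

lemma expGroup_le_idComp [TopologicalSpace G] [IsTopologicalGroup G] (hι : IsClosedEmbedding ι)
    {L : Set A} (hL : L ⊆ lieSet ι K) : expGroup ι L ≤ idComp K := by
  refine expGroup_le_iff.2 fun g X hX hgX => ?_
  choose c hcK hc using hL hX
  have hcont : Continuous c := by
    rw [hι.isEmbedding.continuous_iff, show ι ∘ c = fun t : ℝ => exp (t • X) from funext hc]
    exact continuous_exp_of_real.comp (by fun_prop)
  have hc0 : c 0 = 1 := hι.injective (by rw [hc]; simp)
  have hc1 : c 1 = g := hι.injective (by rw [hc, hgX, one_smul])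
  let path : ℝ → K := fun t => ⟨c t, hcK t⟩
  have hpath : IsPreconnected (Set.range path) := isPreconnected_range (hcont.subtype_mk _)
  exact ⟨path 1, hpath.subset_connectedComponent ⟨0, Subtype.ext hc0⟩ ⟨1, rfl⟩, hc1⟩

variable [FiniteDimensional ℝ A]

-- The bracket is the derivative at `0` of the curve `t ↦ exp (t X) Y exp (-t X)`.
lemma lie_mem_lieSubmodule (hK : IsClosed (ι '' (K : Set G))) {X Y : A}
    (hX : X ∈ lieSubmodule ι K hK) (hY : Y ∈ lieSubmodule ι K hK) :
    X * Y - Y * X ∈ lieSubmodule ι K hK := by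
  set L := lieSubmodule ι K hK
  have hmem : ∀ t : ℝ, exp (t • X) * Y * exp (-(t • X)) ∈ L := by
    intro t
    obtain ⟨g, hg, hgX⟩ := hX t
    rw [← map_inv_eq_exp_neg hgX, ← hgX]
    exact conj_mem_lieSet hg hY
  have hd : HasDerivAt (fun t : ℝ => exp (t • X) * Y * exp (-(t • X))) (X * Y - Y * X) 0 := by
    simpa [sub_eq_add_neg, Pi.mul_def] using
      ((hasDerivAt_exp_smul_zero X).mul_const Y).mul (hasDerivAt_exp_smul_zero (-X))
  refine L.closed_of_finiteDimensional.mem_of_tendsto (hasDerivAt_iff_tendsto_slope.1 hd)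
    (Eventually.of_forall fun t => ?_)
  rw [slope_def_module]
  exact L.smul_mem _ (L.sub_mem (hmem t) (hmem 0))

variable (ι K) in
/-- The Lie algebra of a closed linear group. -/
def lieSubalgebra (hK : IsClosed (ι '' (K : Set G))) : LieSubalgebra ℝ A :=
  { lieSubmodule ι K hK with lie_mem' := fun hX hY => lie_mem_lieSubmodule hK hX hY }

lemma eventually_eq_zero_of_map_eq_exp (hK : IsClosed (ι '' (K : Set G))) {W : Submodule ℝ A}
    (hW : Disjoint (lieSubmodule ι K hK) W) :
    ∀ᶠ v : W in 𝓝 0, (∃ g ∈ K, ι g = exp (v : A)) → v = 0 := by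
  by_contra hcon
  obtain ⟨v, hv0, hv⟩ := exists_seq_forall_of_frequently (not_eventually.1 hcon)
  simp only [Classical.not_imp] at hv
  obtain ⟨y, hy, φ, hφ, hlim⟩ := (isCompact_sphere (0 : W) 1).tendsto_subseq
    (x := fun n => ‖v n‖⁻¹ • v n) fun n => by simp [norm_smul, (hv n).2]
  have hyL : (y : A) ∈ lieSubmodule ι K hK :=
    mem_lieSet_of_tendsto hK (Y := fun n => (v (φ n) : A)) (r := fun n => ‖v (φ n)‖⁻¹)
      (Eventually.of_forall fun n => (hv _).1)
      ((continuous_subtype_val.tendsto (0 : W)).comp (hv0.comp hφ.tendsto_atTop))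
      ((continuous_subtype_val.tendsto y).comp hlim)
  have hy0 : y = 0 := Subtype.ext (Submodule.disjoint_def.1 hW _ hyL y.2)
  simp [hy0] at hy

lemma eventually_exists_eq_exp (hK : IsClosed (ι '' (K : Set G))) :
    ∀ᶠ y in 𝓝 (1 : A), y ∈ ι '' (K : Set G) → ∃ X ∈ lieSet ι K, y = exp X := by
  obtain ⟨W, hW⟩ := (lieSubmodule ι K hK).exists_isCompl
  rw [← map_nhds_zero_exp_mul_exp hW.codisjoint, eventually_map]
  have hsnd : Tendsto Prod.snd (𝓝 (0 : lieSubmodule ι K hK × W)) (𝓝 0) := continuous_snd.tendsto _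
  filter_upwards [hsnd.eventually (eventually_eq_zero_of_map_eq_exp hK hW.disjoint)]
    with p hp hpK
  have hp0 : p.2 = 0 := by
    obtain ⟨g, hg, hgp⟩ := hpK
    obtain ⟨h, hh, hhp⟩ := p.1.2 1
    rw [one_smul] at hhp
    refine hp ⟨h⁻¹ * g, K.mul_mem (K.inv_mem hh) hg, ?_⟩
    rw [map_mul, hgp, map_inv_eq_exp_neg hhp, ← mul_assoc, exp_neg_mul_exp, one_mul]
  exact ⟨p.1, p.1.2, by simp [hp0]⟩

variable [TopologicalSpace G] [IsTopologicalGroup G]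

lemma idComp_eq_expGroup (hι : IsClosedEmbedding ι) {L : Set A}
    (hL : L ⊆ lieSet ι K) (hL' : lieSet ι K.topologicalClosure ⊆ L) :
    idComp K = expGroup ι L := by
  refine le_antisymm (idComp_le_of_eventually ?_) (expGroup_le_idComp hι hL)
  have hone : Tendsto ι (𝓝 1) (𝓝 1) := by simpa using hι.continuous.tendsto (1 : G)
  filter_upwards [hone.eventually
    (eventually_exists_eq_exp (hι.isClosedMap _ K.isClosed_topologicalClosure))] with g hg hgK
  obtain ⟨X, hX, hgX⟩ := hg ⟨g, K.le_topologicalClosure hgK, rfl⟩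
  exact mem_expGroup (hL' hX) hgX

lemma eq_expGroup_of_isConnected (hι : IsClosedEmbedding ι) {F : Subgroup G}
    (hF : IsClosed (F : Set G)) (hc : IsConnected (F : Set G)) : F = expGroup ι (lieSet ι F) := by
  have hcl : F.topologicalClosure = F := SetLike.coe_injective hF.closure_eq
  rw [← idComp_eq_expGroup hι le_rfl (by rw [hcl]), idComp_eq_self hc]

end ClosedSubgroup

section HighestWeight

open LieModule Module

variable {K L M : Type*} [Field K] [LieRing L] [LieAlgebra K L] [AddCommGroup M] [Module K M]
  [LieRingModule L M] [LieModule K L M] {h e f : L} {n : ℕ} {w : M}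

variable (K M) in
/-- The vectors of weight `n` (for `h`) that are killed by `e`, zero included. -/
def highestWeightSpace (h e : L) (n : ℕ) : Submodule K M :=
  LinearMap.ker (toEnd K L M e) ⊓ End.eigenspace (toEnd K L M h) n

lemma mem_highestWeightSpace :
    w ∈ highestWeightSpace K M h e n ↔ ⁅e, w⁆ = 0 ∧ ⁅h, w⁆ = (n : K) • w := by
  simp [highestWeightSpace]

lemma lie_h_toEnd_pow (t : IsSl2Triple h e f) (hw : w ∈ highestWeightSpace K M h e n) (j : ℕ) :
    ⁅h, (toEnd K L M f ^ j) w⁆ = ((n : K) - 2 * j) • (toEnd K L M f ^ j) w := by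
  obtain rfl | hne := eq_or_ne w 0
  · simp
  · obtain ⟨hew, hhw⟩ := mem_highestWeightSpace.1 hw
    exact IsSl2Triple.HasPrimitiveVectorWith.lie_h_pow_toEnd_f (t := t) ⟨hne, hhw, hew⟩ j

lemma lie_e_toEnd_pow_succ (t : IsSl2Triple h e f) (hw : w ∈ highestWeightSpace K M h e n)
    (j : ℕ) : ⁅e, (toEnd K L M f ^ (j + 1)) w⁆ =
      (((j : K) + 1) * (n - j)) • (toEnd K L M f ^ j) w := by
  obtain rfl | hne := eq_or_ne w 0
  · simp
  · obtain ⟨hew, hhw⟩ := mem_highestWeightSpace.1 hw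
    exact IsSl2Triple.HasPrimitiveVectorWith.lie_e_pow_succ_toEnd_f (t := t) ⟨hne, hhw, hew⟩ j

lemma toEnd_e_pow_toEnd_f_pow (t : IsSl2Triple h e f) (hw : w ∈ highestWeightSpace K M h e n)
    (j : ℕ) : (toEnd K L M e ^ j) ((toEnd K L M f ^ j) w) =
      (∏ i ∈ Finset.range j, ((i : K) + 1) * (n - i)) • w := by
  induction j with
  | zero => simp
  | succ j ih =>
    rw [pow_succ, End.mul_apply, toEnd_apply_apply, lie_e_toEnd_pow_succ t hw, map_smul, ih,
      smul_smul, Finset.prod_range_succ, mul_comm]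

lemma toEnd_e_pow_toEnd_f_pow_eq_zero (t : IsSl2Triple h e f)
    (hw : w ∈ highestWeightSpace K M h e n) {i j : ℕ} (hij : i < j) :
    (toEnd K L M e ^ j) ((toEnd K L M f ^ i) w) = 0 := by
  obtain ⟨k, rfl⟩ := Nat.exists_eq_add_of_lt hij
  rw [show i + k + 1 = k + 1 + i by ring, pow_add, End.mul_apply, toEnd_e_pow_toEnd_f_pow t hw,
    map_smul, pow_succ, End.mul_apply, toEnd_apply_apply, (mem_highestWeightSpace.1 hw).1, map_zero,
    smul_zero]

variable (K M) in
/-- The Casimir operator `4 f e + h² + 2 h` of an `sl₂` triple; it acts on the module generated by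
a highest weight vector of weight `n` as the scalar `n (n + 2)`. -/
def sl2Casimir (h e f : L) : End K M :=
  4 * toEnd K L M f * toEnd K L M e + toEnd K L M h ^ 2 + 2 * toEnd K L M h

lemma sl2Casimir_toEnd_pow (t : IsSl2Triple h e f) (hw : w ∈ highestWeightSpace K M h e n)
    (j : ℕ) : sl2Casimir K M h e f ((toEnd K L M f ^ j) w) =
      ((n : K) * (n + 2)) • (toEnd K L M f ^ j) w := by
  have hfe : ⁅f, ⁅e, (toEnd K L M f ^ j) w⁆⁆ = ((j : K) * (n - j + 1)) • (toEnd K L M f ^ j) w := by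
    cases j with
    | zero => simp [(mem_highestWeightSpace.1 hw).1]
    | succ j =>
      rw [lie_e_toEnd_pow_succ t hw, lie_smul, ← toEnd_apply_apply K, ← End.mul_apply, ← pow_succ']
      push_cast
      ring_nf
  simp only [sl2Casimir, pow_two, LinearMap.add_apply, End.mul_apply, toEnd_apply_apply,
    End.ofNat_apply, hfe, lie_h_toEnd_pow t hw, lie_smul, ← Nat.cast_smul_eq_nsmul K, smul_smul,
    ← add_smul]
  push_cast
  ring_nf

lemma mem_of_sum_mem_of_apply_eq_smul {ι : Type*} {T : End K M} {N : Submodule K M}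
    (hT : ∀ x ∈ N, T x ∈ N) {s : Finset ι} {v : ι → M} {μ : ι → K} (hμ : Set.InjOn μ s)
    (hv : ∀ i ∈ s, T (v i) = μ i • v i) (hsum : ∑ i ∈ s, v i ∈ N) : ∀ i ∈ s, v i ∈ N := by
  classical
  induction s using Finset.induction_on generalizing v with
  | empty => simp
  | insert a s ha ih =>
    rw [Finset.coe_insert, Set.injOn_insert (mod_cast ha)] at hμ
    rw [Finset.forall_mem_insert] at hv
    have hdiff : ∑ i ∈ s, (μ i - μ a) • v i ∈ N := by
      have heq : ∑ i ∈ s, (μ i - μ a) • v i =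
          T (∑ i ∈ insert a s, v i) - μ a • ∑ i ∈ insert a s, v i := by
        rw [Finset.sum_insert ha, map_add, map_sum, hv.1, Finset.sum_congr rfl hv.2, smul_add,
          add_sub_add_left_eq_sub, Finset.smul_sum, ← Finset.sum_sub_distrib]
        simp only [sub_smul]
      exact heq ▸ N.sub_mem (hT _ hsum) (N.smul_mem _ hsum)
    have hs : ∀ i ∈ s, v i ∈ N := fun i hi => by
      have hne : μ i - μ a ≠ 0 := sub_ne_zero.2 fun h => hμ.2 ⟨i, hi, h⟩
      exact (N.smul_mem_iff hne).1 <| ih hμ.1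
        (fun j hj => by rw [map_smul, hv.2 j hj, smul_comm]) hdiff i hi
    rw [Finset.sum_insert ha] at hsum
    exact Finset.forall_mem_insert .. |>.2 ⟨(N.add_mem_iff_left (N.sum_mem hs)).1 hsum, hs⟩

variable [CharZero K] {N : Submodule K M}

lemma mem_of_sum_toEnd_pow_mem (t : IsSl2Triple h e f) (he : ∀ x ∈ N, ⁅e, x⁆ ∈ N)
    (hf : ∀ x ∈ N, ⁅f, x⁆ ∈ N) {w : ℕ → M} (hw : ∀ j, w j ∈ highestWeightSpace K M h e n) {d : ℕ}
    (hd : d ≤ n + 1) (hsum : ∑ j ∈ Finset.range d, (toEnd K L M f ^ j) (w j) ∈ N) :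
    ∀ j < d, w j ∈ N := by
  induction d with
  | zero => simp
  | succ d ih =>
    have htop : w d ∈ N := by
      have happly : (toEnd K L M e ^ d) (∑ j ∈ Finset.range (d + 1), (toEnd K L M f ^ j) (w j)) =
          (∏ i ∈ Finset.range d, ((i : K) + 1) * (n - i)) • w d := by
        rw [map_sum, Finset.sum_range_succ, toEnd_e_pow_toEnd_f_pow t (hw d), Finset.sum_eq_zero,
          zero_add]
        exact fun j hj => toEnd_e_pow_toEnd_f_pow_eq_zero t (hw j) (Finset.mem_range.1 hj)
      have hne : ∏ i ∈ Finset.range d, ((i : K) + 1) * (n - i) ≠ 0 :=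
        Finset.prod_ne_zero_iff.2 fun i hi => mul_ne_zero (Nat.cast_add_one_ne_zero i) <|
          sub_ne_zero.2 <| Nat.cast_injective.ne (by have := Finset.mem_range.1 hi; lia)
      exact (N.smul_mem_iff hne).1 (happly ▸ End.pow_apply_mem_of_forall_mem d he _ hsum)
    rw [Finset.sum_range_succ,
      N.add_mem_iff_left (End.pow_apply_mem_of_forall_mem d hf _ htop)] at hsum
    exact Nat.forall_lt_succ_right.2 ⟨ih (by lia) hsum, htop⟩

lemma mem_of_sum_sum_toEnd_pow_mem (t : IsSl2Triple h e f) (he : ∀ x ∈ N, ⁅e, x⁆ ∈ N)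
    (hf : ∀ x ∈ N, ⁅f, x⁆ ∈ N) {ι : Type*} {s : Finset ι} {n : ι → ℕ} (hn : Set.InjOn n s)
    {w : ι → ℕ → M} (hw : ∀ i j, w i j ∈ highestWeightSpace K M h e (n i))
    (hsum : ∑ i ∈ s, ∑ j ∈ Finset.range (n i + 1), (toEnd K L M f ^ j) (w i j) ∈ N) :
    ∀ i ∈ s, ∀ j ≤ n i, w i j ∈ N := by
  have hh : ∀ x ∈ N, ⁅h, x⁆ ∈ N := fun x hx => by
    rw [← t.lie_e_f, lie_lie]
    exact N.sub_mem (he _ (hf _ hx)) (hf _ (he _ hx))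
  have hC : ∀ x ∈ N, sl2Casimir K M h e f x ∈ N := fun x hx => by
    simpa [sl2Casimir, pow_two, ← Nat.cast_smul_eq_nsmul K] using N.add_mem
      (N.add_mem (N.smul_mem 4 (hf _ (he _ hx))) (hh _ (hh _ hx))) (N.smul_mem 2 (hh _ hx))
  have hinj : Set.InjOn (fun i => (n i : K) * (n i + 2)) s := fun i hi j hj hij => by
    have hij : n i * (n i + 2) = n j * (n j + 2) := Nat.cast_injective (R := K) (by simpa using hij)
    exact hn hi hj (by nlinarith)
  have hsplit := mem_of_sum_mem_of_apply_eq_smul hC hinj (fun i _ => by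
    simp only [map_sum, sl2Casimir_toEnd_pow t (hw i _), Finset.smul_sum]) hsum
  exact fun i hi j hj =>
    mem_of_sum_toEnd_pow_mem t he hf (hw i) le_rfl (hsplit i hi) j (Nat.lt_succ_of_le hj)

end HighestWeight

section Prod

open LieModule

variable {L₁ L₂ : Type*} [LieRing L₁] [LieRing L₂] {h e f : L₁} {h' e' f' : L₂}

lemma isSl2Triple_prod (t : IsSl2Triple h e f) (t' : IsSl2Triple h' e' f') :
    IsSl2Triple (h, h') (e, e') (f, f') where
  h_ne_zero h0 := t.h_ne_zero (congrArg Prod.fst h0)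
  lie_e_f := Prod.ext t.lie_e_f t'.lie_e_f
  lie_h_e_nsmul := Prod.ext t.lie_h_e_nsmul t'.lie_h_e_nsmul
  lie_h_f_nsmul := Prod.ext t.lie_h_f_nsmul t'.lie_h_f_nsmul

variable {K : Type*} [Field K] [LieAlgebra K L₁] [LieAlgebra K L₂] {n : ℕ} {x : L₁} {y : L₂}

lemma prodMk_mem_highestWeightSpace (hx : x ∈ highestWeightSpace K L₁ h e n)
    (hy : y ∈ highestWeightSpace K L₂ h' e' n) :
    (x, y) ∈ highestWeightSpace K (L₁ × L₂) (h, h') (e, e') n := by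
  rw [mem_highestWeightSpace] at *
  exact ⟨Prod.ext hx.1 hy.1, Prod.ext hx.2 hy.2⟩

lemma toEnd_prod_pow_apply (j : ℕ) : (toEnd K (L₁ × L₂) (L₁ × L₂) (f, f') ^ j) (x, y) =
    ((toEnd K L₁ L₁ f ^ j) x, (toEnd K L₂ L₂ f' ^ j) y) := by
  induction j with
  | zero => rfl
  | succ j ih => rw [pow_succ', Module.End.mul_apply, ih, pow_succ', pow_succ']; rfl

end Prod

section PrincipalTriple

open LieModule Module

attribute [local instance 100] LieRing.ofAssociativeRing

variable {K A : Type*} [Field K] [Ring A] [Algebra K A] {h e f : A}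

lemma pow_mem_highestWeightSpace (t : IsSl2Triple h e f) (k : ℕ) :
    e ^ k ∈ highestWeightSpace K A h e (2 * k) := by
  refine mem_highestWeightSpace.2 ⟨((Commute.refl e).pow_right k).lie_eq, ?_⟩
  induction k with
  | zero => simp [Ring.lie_def]
  | succ k ih =>
    rw [Ring.lie_def] at ih
    have he : h * e = e * h + (2 : K) • e := by
      rw [← t.lie_h_e_smul K, Ring.lie_def, add_sub_cancel]
    have hk : h * e ^ k = e ^ k * h + ((2 * k : ℕ) : K) • e ^ k := by rw [← ih, add_sub_cancel]
    rw [Ring.lie_def, pow_succ, ← mul_assoc, hk, add_mul, mul_assoc, he, mul_add, smul_mul_assoc,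
      mul_smul_comm, mul_assoc, add_assoc, add_sub_cancel_left, ← add_smul]
    push_cast
    ring_nf

variable [CharZero K] {n : ℕ} {h e f : Matrix (Fin (n + 1)) (Fin (n + 1)) K}

lemma linearIndepOn_toEnd_pow_pow (t : IsSl2Triple h e f) (hn : e ^ n ≠ 0) :
    LinearIndepOn K (fun i : (_ : ℕ) × ℕ => (toEnd K _ _ f ^ i.2) (e ^ i.1))
      ((Finset.range (n + 1)).sigma fun k => Finset.range (2 * k + 1) : Finset ((_ : ℕ) × ℕ)) := by
  rw [linearIndepOn_finset_iff]
  intro a ha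
  rw [Finset.sum_sigma] at ha
  have hmem := mem_of_sum_sum_toEnd_pow_mem (N := ⊥) (n := fun k => 2 * k) t (by simp) (by simp)
    (fun i _ j _ hij => by simpa using hij) (w := fun k j => a ⟨k, j⟩ • e ^ k)
    (fun k j => Submodule.smul_mem _ _ (pow_mem_highestWeightSpace t k))
    (by simpa only [map_smul, Submodule.mem_bot] using ha)
  rintro ⟨k, j⟩ hkj
  obtain ⟨hk, hj⟩ := Finset.mem_sigma.1 hkj
  have hek : e ^ k ≠ 0 := fun h0 => hn (pow_eq_zero_of_le (Finset.mem_range_succ_iff.1 hk) h0)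
  exact (smul_eq_zero_iff_left hek).1 (hmem k hk j (Finset.mem_range_succ_iff.1 hj))

lemma exists_eq_sum_toEnd_pow_pow (t : IsSl2Triple h e f) (hn : e ^ n ≠ 0)
    (X : Matrix (Fin (n + 1)) (Fin (n + 1)) K) : ∃ a : ℕ → ℕ → K, X =
      ∑ k ∈ Finset.range (n + 1), ∑ j ∈ Finset.range (2 * k + 1),
        (toEnd K _ _ f ^ j) (a k j • e ^ k) := by
  have hcard : ∀ n, ∑ k ∈ Finset.range (n + 1), (2 * k + 1) = (n + 1) * (n + 1) := fun n => by
    induction n with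
    | zero => rfl
    | succ n ih => rw [Finset.sum_range_succ, ih]; ring
  have hspan : Submodule.span K ((fun i : (_ : ℕ) × ℕ => (toEnd K _ _ f ^ i.2) (e ^ i.1)) ''
      ((Finset.range (n + 1)).sigma fun k => Finset.range (2 * k + 1) : Finset _)) = ⊤ := by
    rw [Set.image_eq_range]
    exact (linearIndepOn_toEnd_pow_pow t hn).span_eq_top_of_card_eq_finrank'
      (by simp [hcard, finrank_matrix])
  obtain ⟨c, hc⟩ := Submodule.mem_span_image_finset_iff_exists_fun' K |>.1 <|
    hspan ▸ Submodule.mem_top (x := X)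
  exact ⟨fun k j => c ⟨k, j⟩, by simp only [← hc, Finset.sum_sigma, map_smul]⟩

lemma le_of_pow_mem (t : IsSl2Triple h e f) (hn : e ^ n ≠ 0)
    {N N' : Submodule K (Matrix (Fin (n + 1)) (Fin (n + 1)) K)} (he : ∀ x ∈ N, ⁅e, x⁆ ∈ N)
    (hf : ∀ x ∈ N, ⁅f, x⁆ ∈ N) (hf' : ∀ x ∈ N', ⁅f, x⁆ ∈ N')
    (hpow : ∀ k ≤ n, e ^ k ∈ N → e ^ k ∈ N') : N ≤ N' := by
  intro X hX
  obtain ⟨a, rfl⟩ := exists_eq_sum_toEnd_pow_pow t hn X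
  have hmem := mem_of_sum_sum_toEnd_pow_mem (n := fun k => 2 * k) t he hf
    (fun i _ j _ hij => by simpa using hij) (w := fun k j => a k j • e ^ k)
    (fun k j => Submodule.smul_mem _ _ (pow_mem_highestWeightSpace t k)) hX
  refine sum_mem fun k hk => sum_mem fun j hj => End.pow_apply_mem_of_forall_mem j hf' _ ?_
  rw [Finset.mem_range_succ_iff] at hk hj
  obtain ha | ha := eq_or_ne (a k j) 0
  · simp [ha]
  · exact N'.smul_mem _ (hpow k hk ((N.smul_mem_iff ha).1 (hmem k (by simpa using hk) j hj)))

variable {m : ℕ} {h' e' f' : Matrix (Fin (m + 1)) (Fin (m + 1)) K}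

lemma exists_eq_sum_toEnd_prod_pow (t : IsSl2Triple h e f) (t' : IsSl2Triple h' e' f')
    (hn : e ^ n ≠ 0) (hm : e' ^ m ≠ 0) (hmn : m ≤ n)
    (X : Matrix (Fin (n + 1)) (Fin (n + 1)) K × Matrix (Fin (m + 1)) (Fin (m + 1)) K) :
    ∃ a b : ℕ → ℕ → K, X = ∑ k ∈ Finset.range (n + 1), ∑ j ∈ Finset.range (2 * k + 1),
      (toEnd K _ _ (f, f') ^ j) (a k j • e ^ k, b k j • e' ^ k) := by
  obtain ⟨a, ha⟩ := exists_eq_sum_toEnd_pow_pow t hn X.1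
  obtain ⟨b, hb⟩ := exists_eq_sum_toEnd_pow_pow t' hm X.2
  refine ⟨a, fun k => if k ≤ m then b k else 0, Prod.ext ?_ ?_⟩
  · simp only [toEnd_prod_pow_apply, Prod.fst_sum, ← ha]
  · simp only [toEnd_prod_pow_apply, Prod.snd_sum]
    rw [hb, ← Finset.sum_subset (Finset.range_mono (Nat.succ_le_succ hmn)) fun k _ hk => ?_]
    · refine Finset.sum_congr rfl fun k hk => ?_
      rw [if_pos (Finset.mem_range_succ_iff.1 hk)]
    · simp [if_neg (mt Finset.mem_range_succ_iff.2 hk)]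

lemma le_of_prod_pow_mem (t : IsSl2Triple h e f) (t' : IsSl2Triple h' e' f')
    (hn : e ^ n ≠ 0) (hm : e' ^ m ≠ 0) (hmn : m ≤ n) {N N' : Submodule K
      (Matrix (Fin (n + 1)) (Fin (n + 1)) K × Matrix (Fin (m + 1)) (Fin (m + 1)) K)}
    (he : ∀ x ∈ N, ⁅(e, e'), x⁆ ∈ N) (hf : ∀ x ∈ N, ⁅(f, f'), x⁆ ∈ N)
    (hf' : ∀ x ∈ N', ⁅(f, f'), x⁆ ∈ N')
    (hpow : ∀ k ≤ n, ∀ a b : K, (a • e ^ k, b • e' ^ k) ∈ N → (a • e ^ k, b • e' ^ k) ∈ N') :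
    N ≤ N' := by
  intro X hX
  obtain ⟨a, b, rfl⟩ := exists_eq_sum_toEnd_prod_pow t t' hn hm hmn X
  have hmem := mem_of_sum_sum_toEnd_pow_mem (n := fun k => 2 * k) (isSl2Triple_prod t t') he hf
    (fun i _ j _ hij => by simpa using hij) (w := fun k j => (a k j • e ^ k, b k j • e' ^ k))
    (fun k j => prodMk_mem_highestWeightSpace
      (Submodule.smul_mem _ _ (pow_mem_highestWeightSpace t k))
      (Submodule.smul_mem _ _ (pow_mem_highestWeightSpace t' k))) hX
  refine sum_mem fun k hk => sum_mem fun j hj => End.pow_apply_mem_of_forall_mem j hf' _ ?_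
  rw [Finset.mem_range_succ_iff] at hk hj
  exact hpow k hk _ _ (hmem k (by simpa using hk) j hj)

end PrincipalTriple

section PrincipalSubalgebras

open LieAlgebra.SpecialLinear

attribute [local instance 100] LieRing.ofAssociativeRing

section

variable {K A : Type*} [Field K] [Ring A] [Algebra K A] {h e f : A}

lemma lie_pow_apply (t : IsSl2Triple h e f) (i : ℕ) : ⁅h, e ^ i⁆ = (2 * i : K) • e ^ i := by
  simpa using (mem_highestWeightSpace.1 (pow_mem_highestWeightSpace (K := K) t i)).2

lemma lie_pow_lie_pow (t : IsSl2Triple h e f) (i k : ℕ) :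
    ⁅e ^ i, ⁅f, e ^ (k + 1)⁆⁆ = (2 * i * (k + 1) : K) • e ^ (i + k) := by
  have bracket_mul (a b c : A) : ⁅a, b * c⁆ = ⁅a, b⁆ * c + b * ⁅a, c⁆ := by
    simp only [Ring.lie_def]
    noncomm_ring
  have bracket_add (a b c : A) : ⁅a, b + c⁆ = ⁅a, b⁆ + ⁅a, c⁆ := lie_add a b c
  have hfe : ⁅e ^ i, ⁅f, e⁆⁆ = (2 * i : K) • e ^ i := by
    have hef : ⁅f, e⁆ = -h := by rw [← t.lie_e_f]; exact (lie_skew f e).symm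
    rw [hef, ← lie_pow_apply t]
    exact (lie_neg _ _).trans (lie_skew _ _)
  have hcomm (k : ℕ) : ⁅e ^ i, e ^ k⁆ = 0 := (Commute.pow_pow_self e i k).lie_eq
  have hcomm_one : ⁅e ^ i, e⁆ = 0 := (Commute.pow_self e i).lie_eq
  induction k with
  | zero => simp [hfe]
  | succ k ih =>
    rw [pow_succ, bracket_mul f, bracket_add, bracket_mul, bracket_mul, ih, hfe, hcomm, hcomm_one,
      mul_zero, zero_mul, add_zero, zero_add, smul_mul_assoc, mul_smul_comm, ← pow_succ, ← pow_add,
      add_comm (k + 1), ← add_assoc, ← add_smul]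
    push_cast
    ring_nf

lemma trace_pow_eq_zero [CharZero K] {ι : Type*} [Fintype ι] [DecidableEq ι]
    {h e f : Matrix ι ι K} (t : IsSl2Triple h e f) {k : ℕ} (hk : k ≠ 0) : (e ^ k).trace = 0 := by
  have htrace := congrArg trace (lie_pow_apply (K := K) t k)
  rw [LieAlgebra.matrix_trace_commutator_zero, trace_smul, eq_comm, smul_eq_zero] at htrace
  simpa [hk] using htrace

end

/-- The nilpositive element of the principal `sl₂` triple of `𝔤𝔩₅`. -/
def raise5 : Matrix (Fin 5) (Fin 5) ℝ :=
  !![0, 1, 0, 0, 0; 0, 0, 2, 0, 0; 0, 0, 0, 3, 0; 0, 0, 0, 0, 4; 0, 0, 0, 0, 0]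

/-- The nilnegative element of the principal `sl₂` triple of `𝔤𝔩₅`. -/
def lower5 : Matrix (Fin 5) (Fin 5) ℝ :=
  !![0, 0, 0, 0, 0; 4, 0, 0, 0, 0; 0, 3, 0, 0, 0; 0, 0, 2, 0, 0; 0, 0, 0, 1, 0]

/-- The nilpositive element of the principal `sl₂` triple of `𝔤𝔩₃`. -/
def raise3 : Matrix (Fin 3) (Fin 3) ℝ :=
  !![0, 1, 0; 0, 0, 2; 0, 0, 0]

/-- The nilnegative element of the principal `sl₂` triple of `𝔤𝔩₃`. -/
def lower3 : Matrix (Fin 3) (Fin 3) ℝ :=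
  !![0, 0, 0; 2, 0, 0; 0, 1, 0]

lemma isSl2Triple_five : IsSl2Triple ⁅raise5, lower5⁆ raise5 lower5 where
  h_ne_zero h0 := by
    simpa [Ring.lie_def, raise5, lower5] using congrFun₂ h0 0 0
  lie_e_f := rfl
  lie_h_e_nsmul := by norm_num [Ring.lie_def, raise5, lower5, ← zero_empty]
  lie_h_f_nsmul := by norm_num [Ring.lie_def, raise5, lower5, ← zero_empty]

lemma isSl2Triple_three : IsSl2Triple ⁅raise3, lower3⁆ raise3 lower3 where
  h_ne_zero h0 := by
    simpa [Ring.lie_def, raise3, lower3] using congrFun₂ h0 0 0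
  lie_e_f := rfl
  lie_h_e_nsmul := by norm_num [Ring.lie_def, raise3, lower3, ← zero_empty]
  lie_h_f_nsmul := by norm_num [Ring.lie_def, raise3, lower3, ← zero_empty]

lemma raise5_pow_four_ne_zero : raise5 ^ 4 ≠ 0 := fun h => by
  simpa [raise5, pow_succ] using congrFun₂ h 0 4

lemma raise3_pow_two_ne_zero : raise3 ^ 2 ≠ 0 := fun h => by
  simpa [raise3, pow_succ] using congrFun₂ h 0 2

lemma raise3_pow_three : raise3 ^ 3 = 0 := by
  simp [raise3, pow_succ, ← zero_empty]

lemma lie_lie_lower5_raise5_pow_three :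
    ⁅⁅lower5, ⁅lower5, raise5 ^ 3⁆⁆, ⁅lower5, ⁅lower5, ⁅lower5, raise5 ^ 3⁆⁆⁆⁆ =
      (10368 : ℝ) • raise5 + (144 : ℝ) • ⁅lower5, ⁅lower5, raise5 ^ 3⁆⁆ := by
  norm_num [Ring.lie_def, raise5, lower5, pow_succ, ← zero_empty]

lemma lie_lie_lower5_raise5_pow_four :
    ⁅⁅lower5, raise5 ^ 4⁆, ⁅lower5, ⁅lower5, ⁅lower5, ⁅lower5, raise5 ^ 4⁆⁆⁆⁆⁆ =
      (11520 : ℝ) • raise5 ^ 3 := by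
  norm_num [Ring.lie_def, raise5, lower5, pow_succ, ← zero_empty]

lemma lie_lie_lower5_raise5_pow_three_pow_four :
    ⁅⁅lower5, raise5 ^ 3⁆, ⁅lower5, ⁅lower5, ⁅lower5, ⁅lower5, raise5 ^ 4⁆⁆⁆⁆⁆ =
      (-69120 / 7 : ℝ) • raise5 ^ 2 - (2160 / 7 : ℝ) • ⁅lower5, ⁅lower5, raise5 ^ 4⁆⁆ := by
  norm_num [Ring.lie_def, raise5, lower5, pow_succ, ← zero_empty]

lemma lie_lie_lower3_raise3_pow_two :
    ⁅⁅lower3, raise3 ^ 2⁆, ⁅lower3, ⁅lower3, raise3 ^ 2⁆⁆⁆ = (24 : ℝ) • raise3 := by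
  norm_num [Ring.lie_def, raise3, lower3, pow_succ, ← zero_empty]

end PrincipalSubalgebras

section Classification

open LieAlgebra.SpecialLinear

attribute [local instance 100] LieRing.ofAssociativeRing

section

variable {K L : Type*} [Field K] [LieRing L] [LieAlgebra K L] {h e f : L}

lemma nilpositive_mem_toLieSubalgebra (t : IsSl2Triple h e f) : e ∈ t.toLieSubalgebra K :=
  Submodule.subset_span (by simp)

lemma nilnegative_mem_toLieSubalgebra (t : IsSl2Triple h e f) : f ∈ t.toLieSubalgebra K :=
  Submodule.subset_span (by simp)

lemma toLieSubalgebra_le (t : IsSl2Triple h e f) {N : LieSubalgebra K L} (he : e ∈ N)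
    (hf : f ∈ N) : t.toLieSubalgebra K ≤ N := by
  refine Submodule.span_le.2 ?_
  rintro x (rfl | rfl | rfl)
  · exact he
  · exact hf
  · exact t.lie_e_f ▸ N.lie_mem he hf

end

lemma mem_sl_iff {K ι : Type*} [Field K] [Fintype ι] [DecidableEq ι] {X : Matrix ι ι K} :
    X ∈ sl ι K ↔ X.trace = 0 :=
  LinearMap.mem_ker

lemma lieSubalgebra_le_of_pow_mem {K : Type*} [Field K] [CharZero K] {n : ℕ}
    {h e f : Matrix (Fin (n + 1)) (Fin (n + 1)) K} (t : IsSl2Triple h e f) (hn : e ^ n ≠ 0)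
    {N N' : LieSubalgebra K (Matrix (Fin (n + 1)) (Fin (n + 1)) K)}
    (hsl : N ≤ sl (Fin (n + 1)) K) (he : e ∈ N) (hf : f ∈ N) (hf' : f ∈ N')
    (hpow : ∀ k ≠ 0, k ≤ n → e ^ k ∈ N → e ^ k ∈ N') : N ≤ N' := by
  refine le_of_pow_mem (N := N.toSubmodule) (N' := N'.toSubmodule) t hn
    (fun x => N.lie_mem he) (fun x => N.lie_mem hf) (fun x => N'.lie_mem hf') fun k hk hkN => ?_
  obtain rfl | hk0 := eq_or_ne k 0
  · have htrace := mem_sl_iff.1 (hsl hkN)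
    simp [Nat.cast_add_one_ne_zero] at htrace
  · exact hpow k hk0 hk hkN

lemma pow_mem_skewAdjointMatricesLieSubalgebra_iff {K ι : Type*} [Field K] [CharZero K] [Fintype ι]
    [DecidableEq ι] {J E : Matrix ι ι K} (hJ : IsUnit J)
    (hE : E ∈ skewAdjointMatricesLieSubalgebra J) {k : ℕ} (hk : E ^ k ≠ 0) :
    E ^ k ∈ skewAdjointMatricesLieSubalgebra J ↔ Odd k := by
  have hpow : (E ^ k)ᵀ * J = J * (-E) ^ k := by
    rw [transpose_pow]
    exact ((show SemiconjBy J (-E) Eᵀ from Eq.symm (by simpa [Matrix.IsSkewAdjoint,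
      Matrix.IsAdjointPair] using hE)).pow_right k).symm
  have hmem : E ^ k ∈ skewAdjointMatricesLieSubalgebra J ↔ (-E) ^ k = -E ^ k := by
    rw [mem_skewAdjointMatricesLieSubalgebra, mem_skewAdjointMatricesSubmodule,
      Matrix.IsSkewAdjoint, Matrix.IsAdjointPair, hpow, hJ.mul_right_inj]
  rw [hmem]
  refine ⟨fun h => ?_, fun h => h.neg_pow E⟩
  by_contra hodd
  rw [Nat.not_odd_iff_even] at hodd
  rw [hodd.neg_pow, eq_neg_iff_add_eq_zero, ← two_smul K, smul_eq_zero] at h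
  exact h.elim two_ne_zero hk

lemma raise5_pow_ne_zero {k : ℕ} (hk : k ≤ 4) : raise5 ^ k ≠ 0 :=
  fun h => raise5_pow_four_ne_zero (pow_eq_zero_of_le hk h)

/-- The matrix of the invariant quadratic form of the principal `sl₂` triple of `𝔤𝔩₅`, normalized
as the Gram matrix of `Φ₂` at the base point. -/
def baseForm5 : Matrix (Fin 5) (Fin 5) ℝ :=
  !![0, 0, 0, 0, 36; 0, 0, 0, -9, 0; 0, 0, 6, 0, 0; 0, -9, 0, 0, 0; 36, 0, 0, 0, 0]

lemma isUnit_baseForm5 : IsUnit baseForm5 := by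
  rw [isUnit_iff_isUnit_det, isUnit_iff_ne_zero]
  simp [baseForm5, det_succ_row_zero, Fin.sum_univ_succ, Fin.succAbove]

lemma raise5_mem_skewAdjoint : raise5 ∈ skewAdjointMatricesLieSubalgebra baseForm5 := by
  norm_num [Matrix.IsSkewAdjoint, Matrix.IsAdjointPair, raise5, baseForm5, ← Matrix.ext_iff,
    Fin.forall_fin_succ, mul_apply, Fin.sum_univ_succ]

lemma lower5_mem_skewAdjoint : lower5 ∈ skewAdjointMatricesLieSubalgebra baseForm5 := by
  norm_num [Matrix.IsSkewAdjoint, Matrix.IsAdjointPair, lower5, baseForm5, ← Matrix.ext_iff,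
    Fin.forall_fin_succ, mul_apply, Fin.sum_univ_succ]

lemma skewAdjointMatricesLieSubalgebra_le_sl {K ι : Type*} [Field K] [CharZero K]
    [Fintype ι] [DecidableEq ι] {J : Matrix ι ι K} (hJ : IsUnit J) :
    skewAdjointMatricesLieSubalgebra J ≤ sl ι K := by
  intro X hX
  rw [isUnit_iff_isUnit_det] at hJ
  have hX' : Xᵀ * J = J * -X :=
    (mem_skewAdjointMatricesSubmodule J X).1 hX
  have htrace : X.trace = -X.trace := by
    calc X.trace = (Xᵀ * J * J⁻¹).trace := by
          rw [mul_nonsing_inv_cancel_right _ _ hJ, trace_transpose]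
      _ = -X.trace := by
          rw [hX', trace_mul_cycle, nonsing_inv_mul _ hJ, one_mul,
            trace_neg]
  rw [eq_neg_iff_add_eq_zero, ← two_mul, mul_eq_zero] at htrace
  exact mem_sl_iff.2 (htrace.resolve_left two_ne_zero)

section Five

variable {N : LieSubalgebra ℝ (Matrix (Fin 5) (Fin 5) ℝ)}

lemma raise5_mem_of_pow_three_mem (hf : ∀ x ∈ N, ⁅lower5, x⁆ ∈ N) (h3 : raise5 ^ 3 ∈ N) :
    raise5 ∈ N := by
  have hlie := N.lie_mem (hf _ (hf _ h3)) (hf _ (hf _ (hf _ h3)))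
  rw [lie_lie_lower5_raise5_pow_three] at hlie
  exact (N.toSubmodule.smul_mem_iff (by norm_num)).1 <|
    (N.toSubmodule.add_mem_iff_left (N.smul_mem _ (hf _ (hf _ h3)))).1 hlie

lemma raise5_pow_three_mem_of_pow_four_mem (hf : ∀ x ∈ N, ⁅lower5, x⁆ ∈ N)
    (h4 : raise5 ^ 4 ∈ N) : raise5 ^ 3 ∈ N := by
  have hlie := N.lie_mem (hf _ h4) (hf _ (hf _ (hf _ (hf _ h4))))
  rw [lie_lie_lower5_raise5_pow_four] at hlie
  exact (N.toSubmodule.smul_mem_iff (by norm_num)).1 hlie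

lemma raise5_pow_add_mem (hf : ∀ x ∈ N, ⁅lower5, x⁆ ∈ N) {i k : ℕ} (hi : i ≠ 0)
    (hiN : raise5 ^ i ∈ N) (hkN : raise5 ^ (k + 1) ∈ N) : raise5 ^ (i + k) ∈ N := by
  have hlie := N.lie_mem hiN (hf _ hkN)
  rw [lie_pow_lie_pow (K := ℝ) isSl2Triple_five] at hlie
  exact (N.toSubmodule.smul_mem_iff (by positivity)).1 hlie

lemma raise5_pow_three_mem (hf : ∀ x ∈ N, ⁅lower5, x⁆ ∈ N)
    (heven : raise5 ^ 2 ∈ N ∨ raise5 ^ 4 ∈ N) : raise5 ^ 3 ∈ N :=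
  heven.elim (fun h2 => raise5_pow_add_mem hf two_ne_zero h2 h2)
    (raise5_pow_three_mem_of_pow_four_mem hf)

lemma raise5_pow_mem (hf : ∀ x ∈ N, ⁅lower5, x⁆ ∈ N)
    (heven : raise5 ^ 2 ∈ N ∨ raise5 ^ 4 ∈ N) {k : ℕ} (hk0 : k ≠ 0) (hk : k ≤ 4) :
    raise5 ^ k ∈ N := by
  have h3 := raise5_pow_three_mem hf heven
  have h4 : raise5 ^ 4 ∈ N :=
    heven.elim (fun h2 => raise5_pow_add_mem hf two_ne_zero h2 h3) id
  have h2 : raise5 ^ 2 ∈ N := by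
    have hlie := N.lie_mem (hf _ h3) (hf _ (hf _ (hf _ (hf _ h4))))
    rw [lie_lie_lower5_raise5_pow_three_pow_four] at hlie
    exact (N.toSubmodule.smul_mem_iff (by norm_num)).1 <|
      (N.toSubmodule.sub_mem_iff_left (N.smul_mem _ (hf _ (hf _ h4)))).1 hlie
  have hraise : raise5 ^ 1 ∈ N := by simpa using raise5_mem_of_pow_three_mem hf h3
  interval_cases k <;> first | contradiction | assumption

theorem eq_of_mem_five (hsl : N ≤ sl (Fin 5) ℝ) (he : raise5 ∈ N) (hf : lower5 ∈ N) :
    N = isSl2Triple_five.toLieSubalgebra ℝ ∨ N = skewAdjointMatricesLieSubalgebra baseForm5 ∨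
      N = sl (Fin 5) ℝ := by
  have hf' : ∀ x ∈ N, ⁅lower5, x⁆ ∈ N := fun x => N.lie_mem hf
  have hle := toLieSubalgebra_le isSl2Triple_five he hf
  by_cases heven : raise5 ^ 2 ∈ N ∨ raise5 ^ 4 ∈ N
  · exact .inr <| .inr <| hsl.antisymm <| lieSubalgebra_le_of_pow_mem isSl2Triple_five
      raise5_pow_four_ne_zero le_rfl (hsl he) (hsl hf) hf
      fun k hk0 hk _ => raise5_pow_mem hf' heven hk0 hk
  have hodd {k : ℕ} (hk0 : k ≠ 0) (hk : k ≤ 4) (hkN : raise5 ^ k ∈ N) : k = 1 ∨ k = 3 := by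
    interval_cases k <;> simp_all
  by_cases h3 : raise5 ^ 3 ∈ N
  · refine .inr <| .inl <| le_antisymm ?_ ?_
    · refine lieSubalgebra_le_of_pow_mem isSl2Triple_five raise5_pow_four_ne_zero hsl he hf
        lower5_mem_skewAdjoint fun k hk0 hk hkN => ?_
      rw [pow_mem_skewAdjointMatricesLieSubalgebra_iff isUnit_baseForm5 raise5_mem_skewAdjoint
        (raise5_pow_ne_zero hk)]
      obtain rfl | rfl := hodd hk0 hk hkN <;> decide
    · refine lieSubalgebra_le_of_pow_mem isSl2Triple_five raise5_pow_four_ne_zero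
        (skewAdjointMatricesLieSubalgebra_le_sl isUnit_baseForm5) raise5_mem_skewAdjoint
        lower5_mem_skewAdjoint hf fun k hk0 hk hkN => ?_
      rw [pow_mem_skewAdjointMatricesLieSubalgebra_iff isUnit_baseForm5 raise5_mem_skewAdjoint
        (raise5_pow_ne_zero hk)] at hkN
      interval_cases k <;> first | contradiction | simpa using he | assumption
  · refine .inl <| le_antisymm ?_ hle
    refine lieSubalgebra_le_of_pow_mem isSl2Triple_five raise5_pow_four_ne_zero hsl he hf
      (nilnegative_mem_toLieSubalgebra isSl2Triple_five) fun k hk0 hk hkN => ?_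
    obtain rfl | rfl := hodd hk0 hk hkN
    · simpa using nilpositive_mem_toLieSubalgebra isSl2Triple_five
    · contradiction

end Five

theorem eq_of_mem_three {N : LieSubalgebra ℝ (Matrix (Fin 3) (Fin 3) ℝ)}
    (hsl : N ≤ sl (Fin 3) ℝ) (he : raise3 ∈ N) (hf : lower3 ∈ N) :
    N = isSl2Triple_three.toLieSubalgebra ℝ ∨ N = sl (Fin 3) ℝ := by
  by_cases h2 : raise3 ^ 2 ∈ N
  · refine .inr <| hsl.antisymm <| lieSubalgebra_le_of_pow_mem isSl2Triple_three
      raise3_pow_two_ne_zero le_rfl (hsl he) (hsl hf) hf fun k hk0 hk _ => ?_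
    interval_cases k <;> first | contradiction | simpa using he | assumption
  · refine .inl <| le_antisymm ?_ (toLieSubalgebra_le isSl2Triple_three he hf)
    refine lieSubalgebra_le_of_pow_mem isSl2Triple_three raise3_pow_two_ne_zero hsl he hf
      (nilnegative_mem_toLieSubalgebra isSl2Triple_three) fun k hk0 hk hkN => ?_
    interval_cases k
    · contradiction
    · simpa using nilpositive_mem_toLieSubalgebra isSl2Triple_three
    · contradiction

end Classification

section Pair

open LieAlgebra.SpecialLinear

attribute [local instance 100] LieRing.ofAssociativeRing

lemma nilnegative_mem {K L : Type*} [Field K] [CharZero K] [LieRing L] [LieAlgebra K L]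
    {h e f : L} (t : IsSl2Triple h e f) {N : LieSubalgebra K L} (hf : ∀ x ∈ N, ⁅f, x⁆ ∈ N)
    (he : e ∈ N) : f ∈ N := by
  have hlie := hf _ (hf _ he)
  rw [← lie_skew f e, t.lie_e_f, lie_neg, lie_skew, t.lie_h_f_nsmul, ← Nat.cast_smul_eq_nsmul K,
    ← neg_smul] at hlie
  exact (N.toSubmodule.smul_mem_iff (by norm_num)).1 hlie

lemma lie_smul_lie_smul {R L : Type*} [CommRing R] [LieRing L] [LieAlgebra R L] (a : R) (x y : L) :
    ⁅a • x, ⁅y, a • x⁆⁆ = a ^ 2 • ⁅x, ⁅y, x⁆⁆ := by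
  rw [lie_smul, lie_smul, smul_lie, smul_smul, sq]

lemma lieSubalgebra_le_of_prod_pow_mem {K : Type*} [Field K] [CharZero K] {n m : ℕ}
    {h e f : Matrix (Fin (n + 1)) (Fin (n + 1)) K} {h' e' f' : Matrix (Fin (m + 1)) (Fin (m + 1)) K}
    (t : IsSl2Triple h e f) (t' : IsSl2Triple h' e' f') (hn : e ^ n ≠ 0) (hm : e' ^ m ≠ 0)
    (hmn : m ≤ n) {N N' : LieSubalgebra K
      (Matrix (Fin (n + 1)) (Fin (n + 1)) K × Matrix (Fin (m + 1)) (Fin (m + 1)) K)}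
    (hsl : ∀ x ∈ N, x.1 ∈ sl (Fin (n + 1)) K ∧ x.2 ∈ sl (Fin (m + 1)) K)
    (he : (e, e') ∈ N) (hf : (f, f') ∈ N) (hf' : (f, f') ∈ N')
    (hpow : ∀ k ≠ 0, k ≤ n → ∀ a b : K, (a • e ^ k, b • e' ^ k) ∈ N →
      (a • e ^ k, b • e' ^ k) ∈ N') : N ≤ N' := by
  refine le_of_prod_pow_mem (N := N.toSubmodule) (N' := N'.toSubmodule) t t' hn hm hmn
    (fun x => N.lie_mem he) (fun x => N.lie_mem hf) (fun x => N'.lie_mem hf')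
    fun k hk a b hkN => ?_
  obtain rfl | hk0 := eq_or_ne k 0
  · have htrace := And.imp mem_sl_iff.1 mem_sl_iff.1 (hsl _ hkN)
    simp only [pow_zero, trace_smul, trace_one, Fintype.card_fin, smul_eq_mul, mul_eq_zero,
      Nat.cast_add_one, Nat.cast_add_one_ne_zero, or_false] at htrace
    rw [htrace.1, htrace.2, zero_smul, zero_smul]
    exact N'.zero_mem
  · exact hpow k hk0 hk a b hkN

variable {N : LieSubalgebra ℝ (Matrix (Fin 5) (Fin 5) ℝ × Matrix (Fin 3) (Fin 3) ℝ)}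

lemma isSl2Triple_five_three : IsSl2Triple (⁅raise5, lower5⁆, ⁅raise3, lower3⁆)
    (raise5, raise3) (lower5, lower3) :=
  isSl2Triple_prod isSl2Triple_five isSl2Triple_three

lemma lie_lower5_mem_comap_inl (hf : (lower5, lower3) ∈ N) :
    ∀ X ∈ N.comap (LieHom.inl ℝ _ _), ⁅lower5, X⁆ ∈ N.comap (LieHom.inl ℝ _ _) := fun X hX => by
  simpa using N.lie_mem hf hX

lemma lie_lower3_mem_comap_inr (hf : (lower5, lower3) ∈ N) :
    ∀ X ∈ N.comap (LieHom.inr ℝ _ _), ⁅lower3, X⁆ ∈ N.comap (LieHom.inr ℝ _ _) := fun X hX => by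
  simpa using N.lie_mem hf hX

lemma raise5_mem_comap_inl_of_pow_three_mem (hf : (lower5, lower3) ∈ N)
    (h3 : raise5 ^ 3 ∈ N.comap (LieHom.inl ℝ _ _)) : raise5 ∈ N.comap (LieHom.inl ℝ _ _) :=
  raise5_mem_of_pow_three_mem (lie_lower5_mem_comap_inl hf) h3

lemma raise5_mem_comap_inl_of_pow_two_mem (he : (raise5, raise3) ∈ N)
    (hf : (lower5, lower3) ∈ N) {a b : ℝ} (hx0 : (a • raise5 ^ 2, b • raise3 ^ 2) ≠ 0)
    (hx : (a • raise5 ^ 2, b • raise3 ^ 2) ∈ N) : raise5 ∈ N.comap (LieHom.inl ℝ _ _) := by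
  have hf₂ := lie_lower3_mem_comap_inr hf
  obtain rfl | ha := eq_or_ne a 0
  · have hb : b ≠ 0 := by rintro rfl; simp at hx0
    have h2 : raise3 ^ 2 ∈ N.comap (LieHom.inr ℝ _ _) :=
      (LieSubalgebra.toSubmodule _).smul_mem_iff hb |>.1 (by simpa using hx)
    have hraise : raise3 ∈ N.comap (LieHom.inr ℝ _ _) := by
      have hlie := LieSubalgebra.lie_mem _ (hf₂ _ h2) (hf₂ _ (hf₂ _ h2))
      rw [lie_lie_lower3_raise3_pow_two] at hlie
      exact ((LieSubalgebra.toSubmodule _).smul_mem_iff (by norm_num)).1 hlie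
    simpa using N.sub_mem he hraise
  · refine raise5_mem_comap_inl_of_pow_three_mem hf ?_
    have hlie := N.lie_mem hx (N.lie_mem hf hx)
    have heq : ⁅(a • raise5 ^ 2, b • raise3 ^ 2),
        ⁅(lower5, lower3), (a • raise5 ^ 2, b • raise3 ^ 2)⁆⁆ =
          (8 * a ^ 2) • ((raise5 ^ 3, 0) :
            Matrix (Fin 5) (Fin 5) ℝ × Matrix (Fin 3) (Fin 3) ℝ) := by
      refine Prod.ext ((lie_smul_lie_smul a (raise5 ^ 2) lower5).trans ?_)
        ((lie_smul_lie_smul b (raise3 ^ 2) lower3).trans ?_)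
      · rw [lie_pow_lie_pow (K := ℝ) isSl2Triple_five 2 1, Prod.smul_fst, smul_smul]
        norm_num [mul_comm]
      · rw [lie_pow_lie_pow (K := ℝ) isSl2Triple_three 2 1, raise3_pow_three]
        simp
    rw [heq] at hlie
    exact (N.toSubmodule.smul_mem_iff (by positivity)).1 hlie

lemma raise5_mem_comap_inl (he : (raise5, raise3) ∈ N) (hf : (lower5, lower3) ∈ N) {k : ℕ}
    (hk0 : k ≠ 0) (hk : k ≤ 4) {a b : ℝ} (hx : (a • raise5 ^ k, b • raise3 ^ k) ∈ N)
    (hdiag : (a • raise5 ^ k, b • raise3 ^ k) ∉ isSl2Triple_five_three.toLieSubalgebra ℝ) :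
    raise5 ∈ N.comap (LieHom.inl ℝ _ _) := by
  have hx0 : (a • raise5 ^ k, b • raise3 ^ k) ≠ 0 := fun h0 => hdiag (h0 ▸ LieSubalgebra.zero_mem _)
  have pow_mem (hk3 : 3 ≤ k) : raise5 ^ k ∈ N.comap (LieHom.inl ℝ _ _) := by
    have h0 : raise3 ^ k = 0 := pow_eq_zero_of_le hk3 raise3_pow_three
    have ha : a ≠ 0 := by rintro rfl; simp [h0] at hx0
    rw [h0, smul_zero] at hx
    exact ((LieSubalgebra.toSubmodule _).smul_mem_iff ha).1 hx
  interval_cases k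
  · contradiction
  · have hab : a - b ≠ 0 := fun hab => hdiag <| by
      rw [sub_eq_zero.1 hab, pow_one, pow_one]
      exact LieSubalgebra.smul_mem _ b (nilpositive_mem_toLieSubalgebra isSl2Triple_five_three)
    refine ((LieSubalgebra.toSubmodule _).smul_mem_iff hab).1 ?_
    simpa [sub_smul] using N.sub_mem hx (N.smul_mem b he)
  · exact raise5_mem_comap_inl_of_pow_two_mem he hf hx0 hx
  · exact raise5_mem_comap_inl_of_pow_three_mem hf (pow_mem le_rfl)
  · exact raise5_mem_comap_inl_of_pow_three_mem hf <|
      raise5_pow_three_mem_of_pow_four_mem (lie_lower5_mem_comap_inl hf) (pow_mem (by decide))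

variable (hsl : ∀ x ∈ N, x.1 ∈ sl (Fin 5) ℝ ∧ x.2 ∈ sl (Fin 3) ℝ)
include hsl

lemma eq_toLieSubalgebra_or_raise5_mem_comap_inl (he : (raise5, raise3) ∈ N)
    (hf : (lower5, lower3) ∈ N) : N = isSl2Triple_five_three.toLieSubalgebra ℝ ∨
      raise5 ∈ N.comap (LieHom.inl ℝ _ _) := by
  by_contra! h
  refine h.1 (le_antisymm ?_ (toLieSubalgebra_le isSl2Triple_five_three he hf))
  refine lieSubalgebra_le_of_prod_pow_mem isSl2Triple_five isSl2Triple_three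
    raise5_pow_four_ne_zero raise3_pow_two_ne_zero (by decide) hsl he hf
    (nilnegative_mem_toLieSubalgebra isSl2Triple_five_three) fun k hk0 hk a b hx => ?_
  by_contra hdiag
  exact h.2 (raise5_mem_comap_inl he hf hk0 hk hx hdiag)

-- Bracketing with `(h₅, 0)` isolates the first component of a highest weight vector.
lemma prodMk_zero_mem_of_mem (he : (raise5, raise3) ∈ N) (hf : (lower5, lower3) ∈ N)
    (hraise : raise5 ∈ N.comap (LieHom.inl ℝ _ _))
    {x : Matrix (Fin 5) (Fin 5) ℝ × Matrix (Fin 3) (Fin 3) ℝ} (hx : x ∈ N) : (x.1, 0) ∈ N := by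
  have hf₁ := nilnegative_mem isSl2Triple_five (lie_lower5_mem_comap_inl hf) hraise
  refine lieSubalgebra_le_of_prod_pow_mem
    (N' := (N.comap (LieHom.inl ℝ _ _)).comap (LieHom.fst ℝ _ _)) isSl2Triple_five
    isSl2Triple_three raise5_pow_four_ne_zero raise3_pow_two_ne_zero (by decide) hsl he hf hf₁
    (fun k hk0 _ a b hab => ?_) hx
  have hlie : (⁅⁅raise5, lower5⁆, a • raise5 ^ k⁆,
      ⁅(0 : Matrix (Fin 3) (Fin 3) ℝ), b • raise3 ^ k⁆) ∈ N :=
    N.lie_mem ((N.comap (LieHom.inl ℝ _ _)).lie_mem hraise hf₁) hab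
  have hweight : ⁅⁅raise5, lower5⁆, a • raise5 ^ k⁆ = (2 * k : ℝ) • (a • raise5 ^ k) := by
    rw [smul_comm, ← lie_pow_apply isSl2Triple_five]
    exact lie_smul a _ _
  rw [hweight] at hlie
  exact (N.toSubmodule.smul_mem_iff (s := (2 * k : ℝ)) (by positivity)).1 (by simpa using hlie)

theorem eq_of_mem_five_three (he : (raise5, raise3) ∈ N) (hf : (lower5, lower3) ∈ N) :
    N = isSl2Triple_five_three.toLieSubalgebra ℝ ∨
      ∃ N₁ ∈ ({isSl2Triple_five.toLieSubalgebra ℝ, skewAdjointMatricesLieSubalgebra baseForm5,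
          sl (Fin 5) ℝ} : Set (LieSubalgebra ℝ (Matrix (Fin 5) (Fin 5) ℝ))),
        ∃ N₂ ∈ ({isSl2Triple_three.toLieSubalgebra ℝ, sl (Fin 3) ℝ} :
          Set (LieSubalgebra ℝ (Matrix (Fin 3) (Fin 3) ℝ))),
          N.toSubmodule = N₁.toSubmodule.prod N₂.toSubmodule := by
  refine (eq_toLieSubalgebra_or_raise5_mem_comap_inl hsl he hf).imp_right fun hraise => ?_
  have hf₁ := nilnegative_mem isSl2Triple_five (lie_lower5_mem_comap_inl hf) hraise
  have prodMk_zero_mem {x} (hx : x ∈ N) : (x.1, 0) ∈ N := prodMk_zero_mem_of_mem hsl he hf hraise hx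
  have zero_prodMk_mem {x} (hx : x ∈ N) : (0, x.2) ∈ N := by
    have hsub := N.sub_mem hx (prodMk_zero_mem hx)
    rwa [show x - (x.1, 0) = (0, x.2) from Prod.ext (sub_self _) (sub_zero _)] at hsub
  refine ⟨N.comap (LieHom.inl ℝ _ _), ?_, N.comap (LieHom.inr ℝ _ _), ?_, Submodule.ext fun x =>
    ⟨fun hx => ⟨prodMk_zero_mem hx, zero_prodMk_mem hx⟩, fun hx => ?_⟩⟩
  · exact eq_of_mem_five (fun X hX => (hsl _ hX).1) hraise hf₁
  · exact eq_of_mem_three (fun X hX => (hsl _ hX).2) (zero_prodMk_mem he) (zero_prodMk_mem hf)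
  · simpa using N.add_mem hx.1 hx.2

end Pair

section OneParameterGroup

open NormedSpace Filter Topology

lemma eq_of_hasDerivAt_zero_of_flow {E : Type*} [NormedAddCommGroup E] [NormedSpace ℝ E]
    {γ : ℝ → E} (h0 : HasDerivAt γ 0 0) (hflow : ∀ s, ∃ T : E →L[ℝ] E, ∀ t, γ (s + t) = T (γ t))
    (t : ℝ) : γ t = γ 0 := by
  have hderiv (s : ℝ) : HasDerivAt γ 0 s := by
    obtain ⟨T, hT⟩ := hflow s
    have h0' : HasDerivAt γ 0 (s - s) := by rwa [sub_self]
    have hshift := T.hasFDerivAt.comp_hasDerivAt s (h0'.comp_sub_const s s)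
    rw [map_zero] at hshift
    exact hshift.congr_of_eventuallyEq (Eventually.of_forall fun r => by
      rw [Function.comp_apply, ← hT, add_sub_cancel])
  exact is_const_of_deriv_eq_zero (fun s => (hderiv s).differentiableAt)
    (fun s => (hderiv s).deriv) t 0

lemma lieSet_mono {A G : Type*} [NormedRing A] [NormedAlgebra ℝ A] [Group G] {ι : G →* A}
    {K K' : Subgroup G} (h : K ≤ K') : lieSet ι K ⊆ lieSet ι K' := fun _ hX t =>
  let ⟨g, hg, hgX⟩ := hX t
  ⟨g, h hg, hgX⟩

lemma exp_add_smul {A : Type*} [NormedRing A] [NormedAlgebra ℝ A] [CompleteSpace A]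
    (s t : ℝ) (X : A) : exp ((s + t) • X) = exp (s • X) * exp (t • X) := by
  let := NormedAlgebra.restrictScalars ℚ ℝ A
  rw [add_smul, exp_add_of_commute (((Commute.refl X).smul_left s).smul_right t)]

lemma eq_zero_of_mem_lieSet_topologicalClosure {A E G : Type*} [NormedRing A] [NormedAlgebra ℝ A]
    [NormedAddCommGroup E] [NormedSpace ℝ E] [Group G] [TopologicalSpace G] [IsTopologicalGroup G]
    {ι : G →* A} (hι : Continuous ι) {f : A → E} (hf : Continuous f) {c : E} {K : Subgroup G}
    (hK : ∀ g ∈ K, f (ι g) = c) {X : A} (hX : X ∈ lieSet ι K.topologicalClosure) {f' : E}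
    (hd : HasDerivAt (fun t : ℝ => f (exp (t • X))) f' 0) : f' = 0 := by
  have hclosure : ∀ g ∈ K.topologicalClosure, f (ι g) = c := fun g hg =>
    closure_minimal (t := {g | f (ι g) = c}) hK (isClosed_eq (hf.comp hι) continuous_const) hg
  have hconst (t : ℝ) : f (exp (t • X)) = c := by
    obtain ⟨g, hg, hgX⟩ := hX t
    rw [← hgX, hclosure g hg]
  refine hd.unique ?_
  simp only [hconst]
  exact hasDerivAt_const 0 c

end OneParameterGroup

section SpecialLinear

open NormedSpace Filter Topology LieAlgebra.SpecialLinear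

attribute [local instance] Matrix.linftyOpNormedRing Matrix.linftyOpNormedAlgebra
attribute [local instance 100] LieRing.ofAssociativeRing

variable {n : Type*} [Fintype n] [DecidableEq n]

lemma differentiable_det : Differentiable ℝ (Matrix.det : Matrix n n ℝ → ℝ) := by
  have hentry (i j) : Differentiable ℝ fun X : Matrix n n ℝ => X i j :=
    (LinearMap.toContinuousLinearMap (Matrix.entryLinearMap ℝ ℝ i j)).differentiable
  rw [show (Matrix.det : Matrix n n ℝ → ℝ) = fun X => ∑ σ : Equiv.Perm n,
    (Equiv.Perm.sign σ : ℝ) * ∏ i, X (σ i) i from funext Matrix.det_apply']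
  fun_prop (disch := exact hentry _ _)

lemma hasDerivAt_det_one_add_smul (X : Matrix n n ℝ) :
    HasDerivAt (fun t : ℝ => (1 + t • X).det) X.trace 0 := by
  have hpoly := (det (1 + (Polynomial.X : Polynomial ℝ) • X.map Polynomial.C)).hasDerivAt 0
  rw [derivative_det_one_add_X_smul] at hpoly
  refine hpoly.congr_of_eventuallyEq (Eventually.of_forall fun t => ?_)
  simp [eval_det, ← smul_eq_mul_diagonal]

lemma hasDerivAt_det_exp_smul_zero (X : Matrix n n ℝ) :
    HasDerivAt (fun t : ℝ => (exp (t • X)).det) X.trace 0 := by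
  have hline : HasDerivAt (fun t : ℝ => 1 + t • X) X 0 := by
    have := ((hasDerivAt_id (0 : ℝ)).smul_const X).const_add (1 : Matrix n n ℝ)
    rwa [one_smul] at this
  have hdet : HasFDerivAt Matrix.det (fderiv ℝ Matrix.det (1 : Matrix n n ℝ)) 1 :=
    (differentiable_det 1).hasFDerivAt
  have htrace : fderiv ℝ Matrix.det 1 X = X.trace :=
    (hdet.comp_hasDerivAt_of_eq 0 hline (by simp)).unique
      (hasDerivAt_det_one_add_smul X)
  rw [← htrace]
  exact hdet.comp_hasDerivAt_of_eq 0 (hasDerivAt_exp_smul_zero X) (by simp)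

lemma det_exp_eq_one {X : Matrix n n ℝ} (hX : X.trace = 0) : (exp X).det = 1 := by
  have hconst := eq_of_hasDerivAt_zero_of_flow (γ := fun t : ℝ => (exp (t • X)).det)
    (hX ▸ hasDerivAt_det_exp_smul_zero X)
    (fun s => ⟨(exp (s • X)).det • ContinuousLinearMap.id ℝ ℝ, fun t =>
      (congrArg det (exp_add_smul s t X)).trans (det_mul _ _)⟩) 1
  simpa using hconst

lemma lieSet_top_eq_sl : lieSet (SpecialLinearGroup.coeMonoidHom :
    SpecialLinearGroup n ℝ →* Matrix n n ℝ) ⊤ = sl n ℝ := by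
  ext X
  rw [SetLike.mem_coe, mem_sl_iff]
  refine ⟨fun hX => ?_, fun hX t =>
    ⟨⟨exp (t • X), det_exp_eq_one (by rw [trace_smul, hX, smul_zero])⟩, trivial, rfl⟩⟩
  exact eq_zero_of_mem_lieSet_topologicalClosure continuous_subtype_val
    differentiable_det.continuous (fun g _ => g.2)
    (lieSet_mono (Subgroup.le_topologicalClosure ⊤) hX) (hasDerivAt_det_exp_smul_zero X)

lemma exp_eq_one_add_of_mul_self_eq_zero {A : Type*} [NormedRing A] [NormedAlgebra ℝ A] {X : A}
    (hX : X * X = 0) : exp X = 1 + X := by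
  have hpow : ∀ k ∉ Finset.range 2, ((k.factorial : ℝ)⁻¹) • X ^ k = 0 := by
    intro k hk
    obtain ⟨m, rfl⟩ := Nat.exists_eq_add_of_le' (not_lt.1 (Finset.mem_range.not.1 hk))
    rw [pow_add, pow_two, hX, mul_zero, smul_zero]
  rw [exp_eq_tsum ℝ]
  exact (tsum_eq_sum hpow).trans (by simp [Finset.sum_range_succ])

lemma diag2n_eq_mul_transvection {i j : n} (hij : i ≠ j) {c : ℝ} (hc : c ≠ 0) :
    SpecialLinearGroup.diag2n hij c hc =
      (SpecialLinearGroup.transvection hij c * SpecialLinearGroup.transvection hij.symm (-c⁻¹) *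
        SpecialLinearGroup.transvection hij c) *
      (SpecialLinearGroup.transvection hij (-1) * SpecialLinearGroup.transvection hij.symm 1 *
        SpecialLinearGroup.transvection hij (-1)) := by
  have hdiag : (SpecialLinearGroup.diag2n hij c hc : Matrix n n ℝ) =
      1 + single i i (c - 1) + single j j (c⁻¹ - 1) := by
    ext a b
    simp only [SpecialLinearGroup.diag2n_coe, diagonal_apply, Matrix.add_apply, one_apply,
      single_apply]
    grind
  apply Subtype.ext
  rw [hdiag]
  ext a b
  simp [SpecialLinearGroup.transvection_coe, mul_add, add_mul, hij, hij.symm, hc, single_apply,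
    one_apply]
  grind

lemma expGroup_sl [Nontrivial n] : expGroup (SpecialLinearGroup.coeMonoidHom :
    SpecialLinearGroup n ℝ →* Matrix n n ℝ) (sl n ℝ : Set (Matrix n n ℝ)) = ⊤ := by
  set P := expGroup (SpecialLinearGroup.coeMonoidHom :
    SpecialLinearGroup n ℝ →* Matrix n n ℝ) (sl n ℝ : Set (Matrix n n ℝ))
  have htransvection : ∀ (i j : n) (hij : i ≠ j) (c : ℝ),
      SpecialLinearGroup.transvection hij c ∈ P := by
    intro i j hij c
    refine mem_expGroup (X := single i j c) (mem_sl_iff.2 (trace_single_eq_of_ne i j c hij)) ?_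
    rw [exp_eq_one_add_of_mul_self_eq_zero (single_mul_single_of_ne _ _ _ _ hij.symm _)]
    rfl
  refine eq_top_iff.2 fun g _ => SpecialLinearGroup.diagonal_transvection_induction' (· ∈ P) g
    (fun i j hij c hc => ?_) htransvection (fun _ _ => P.mul_mem)
  rw [diag2n_eq_mul_transvection]
  apply_rules [P.mul_mem, htransvection]

end SpecialLinear

section Prod

open NormedSpace

variable {A₁ A₂ : Type*} [NormedRing A₁] [NormedAlgebra ℝ A₁] [CompleteSpace A₁]
  [NormedRing A₂] [NormedAlgebra ℝ A₂] [CompleteSpace A₂]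

lemma exp_prodMk (X : A₁) (Y : A₂) : exp (X, Y) = (exp X, exp Y) := by
  let := NormedAlgebra.restrictScalars ℚ ℝ A₁
  let := NormedAlgebra.restrictScalars ℚ ℝ A₂
  exact Prod.ext (Prod.fst_exp (X, Y)) (Prod.snd_exp (X, Y))

lemma expGroup_prod {G₁ G₂ : Type*} [Group G₁] [Group G₂] (ι₁ : G₁ →* A₁) (ι₂ : G₂ →* A₂)
    (L₁ : Submodule ℝ A₁) (L₂ : Submodule ℝ A₂) :
    expGroup (ι₁.prodMap ι₂) (L₁.prod L₂ : Set (A₁ × A₂)) =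
      (expGroup ι₁ (L₁ : Set A₁)).prod (expGroup ι₂ (L₂ : Set A₂)) := by
  apply le_antisymm
  · rw [expGroup_le_iff]
    rintro ⟨g₁, g₂⟩ ⟨X, Y⟩ hXY hg
    replace hg := hg.trans (exp_prodMk X Y)
    exact ⟨mem_expGroup hXY.1 (congrArg Prod.fst hg), mem_expGroup hXY.2 (congrArg Prod.snd hg)⟩
  · rw [Subgroup.prod_le_iff, Subgroup.map_le_iff_le_comap, Subgroup.map_le_iff_le_comap,
      expGroup_le_iff, expGroup_le_iff]
    exact ⟨fun g X hX hg => mem_expGroup (X := (X, 0)) ⟨hX, L₂.zero_mem⟩ (by simp [exp_prodMk, hg]),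
      fun g Y hY hg => mem_expGroup (X := (0, Y)) ⟨L₁.zero_mem, hY⟩ (by simp [exp_prodMk, hg])⟩

lemma fst_mem_lieSet {G₁ G₂ : Type*} [Group G₁] [Group G₂] {ι₁ : G₁ →* A₁} {ι₂ : G₂ →* A₂}
    {K : Subgroup (G₁ × G₂)} {X : A₁ × A₂} (hX : X ∈ lieSet (ι₁.prodMap ι₂) K) :
    X.1 ∈ lieSet ι₁ (K.map (MonoidHom.fst G₁ G₂)) := fun t => by
  obtain ⟨g, hg, hgX⟩ := hX t
  exact ⟨g.1, ⟨g, hg, rfl⟩, congrArg Prod.fst (hgX.trans (exp_prodMk (t • X.1) (t • X.2)))⟩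

lemma snd_mem_lieSet {G₁ G₂ : Type*} [Group G₁] [Group G₂] {ι₁ : G₁ →* A₁} {ι₂ : G₂ →* A₂}
    {K : Subgroup (G₁ × G₂)} {X : A₁ × A₂} (hX : X ∈ lieSet (ι₁.prodMap ι₂) K) :
    X.2 ∈ lieSet ι₂ (K.map (MonoidHom.snd G₁ G₂)) := fun t => by
  obtain ⟨g, hg, hgX⟩ := hX t
  exact ⟨g.2, ⟨g, hg, rfl⟩, congrArg Prod.snd (hgX.trans (exp_prodMk (t • X.1) (t • X.2)))⟩

end Prod

section Pair

attribute [local instance] Matrix.linftyOpNormedRing Matrix.linftyOpNormedAlgebra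

/-- The representation of `SL(n) × SL(m)` on pairs of matrices, through which its subgroups are
treated as linear groups. -/
def pairHom (n m : Type*) [Fintype n] [DecidableEq n] [Fintype m] [DecidableEq m] :
    SpecialLinearGroup n ℝ × SpecialLinearGroup m ℝ →* Matrix n n ℝ × Matrix m m ℝ :=
  SpecialLinearGroup.coeMonoidHom.prodMap SpecialLinearGroup.coeMonoidHom

variable {n m : Type*} [Fintype n] [DecidableEq n] [Fintype m] [DecidableEq m]

lemma isClosedEmbedding_coeMonoidHom : Topology.IsClosedEmbedding
    (SpecialLinearGroup.coeMonoidHom : SpecialLinearGroup n ℝ →* Matrix n n ℝ) :=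
  SpecialLinearGroup.isClosedEmbedding_val

lemma isClosedEmbedding_pairHom : Topology.IsClosedEmbedding (pairHom n m) :=
  isClosedEmbedding_coeMonoidHom.prodMap isClosedEmbedding_coeMonoidHom

lemma fst_mem_sl_and_snd_mem_sl {K : Subgroup (SpecialLinearGroup n ℝ × SpecialLinearGroup m ℝ)}
    {X : Matrix n n ℝ × Matrix m m ℝ} (hX : X ∈ lieSet (pairHom n m) K) :
    X.1 ∈ LieAlgebra.SpecialLinear.sl n ℝ ∧ X.2 ∈ LieAlgebra.SpecialLinear.sl m ℝ := by
  simp only [← SetLike.mem_coe, ← lieSet_top_eq_sl]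
  exact ⟨lieSet_mono le_top (fst_mem_lieSet hX), lieSet_mono le_top (snd_mem_lieSet hX)⟩

end Pair

section Pfaffians

/-- The polarization of the signed `4 × 4` Pfaffians, normalized so that
`a ⬝ᵥ pfaffPolar u v` is the coefficient of `m₀ ∧ ⋯ ∧ m₄` in `a ∧ u ∧ v`. -/
def pfaffPolar : Matrix (Fin 5) (Fin 5) ℝ →ₗ[ℝ] Matrix (Fin 5) (Fin 5) ℝ →ₗ[ℝ] Fin 5 → ℝ :=
  LinearMap.mk₂ ℝ (fun u v =>
    ![u 1 2 * v 3 4 + u 3 4 * v 1 2 - u 1 3 * v 2 4 - u 2 4 * v 1 3 + u 1 4 * v 2 3 + u 2 3 * v 1 4,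
      -(u 0 2 * v 3 4 + u 3 4 * v 0 2 - u 0 3 * v 2 4 - u 2 4 * v 0 3 + u 0 4 * v 2 3 +
        u 2 3 * v 0 4),
      u 0 1 * v 3 4 + u 3 4 * v 0 1 - u 0 3 * v 1 4 - u 1 4 * v 0 3 + u 0 4 * v 1 3 + u 1 3 * v 0 4,
      -(u 0 1 * v 2 4 + u 2 4 * v 0 1 - u 0 2 * v 1 4 - u 1 4 * v 0 2 + u 0 4 * v 1 2 +
        u 1 2 * v 0 4),
      u 0 1 * v 2 3 + u 2 3 * v 0 1 - u 0 2 * v 1 3 - u 1 3 * v 0 2 + u 0 3 * v 1 2 +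
        u 1 2 * v 0 3])
    (fun u u' v => by ext i; fin_cases i <;> simp <;> ring)
    (fun c u v => by ext i; fin_cases i <;> simp <;> ring)
    (fun u v v' => by ext i; fin_cases i <;> simp <;> ring)
    (fun c u v => by ext i; fin_cases i <;> simp <;> ring)

/-- The wedge product `p ∧ q` of two vectors, as an alternating matrix. -/
def vecWedge (p q : Fin 5 → ℝ) : Matrix (Fin 5) (Fin 5) ℝ :=
  vecMulVec p q - vecMulVec q p

lemma mul_vecWedge_mul_transpose (A : Matrix (Fin 5) (Fin 5) ℝ) (p q : Fin 5 → ℝ) :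
    A * vecWedge p q * Aᵀ = vecWedge (A *ᵥ p) (A *ᵥ q) := by
  simp only [vecWedge, mul_sub, sub_mul, mul_vecMulVec, vecMulVec_mul, vecMul_transpose]

lemma mem_span_vecWedge {u : Matrix (Fin 5) (Fin 5) ℝ} (hu : uᵀ = -u) :
    u ∈ Submodule.span ℝ {w | ∃ p q, w = vecWedge p q} := by
  have hsum : u = ∑ i, ∑ j, (u i j / 2) • vecWedge (Pi.single i 1) (Pi.single j 1) := by
    have hanti (i j) : u j i = -u i j := congrFun₂ hu i j
    ext k l
    simp only [vecWedge, Matrix.sum_apply, Matrix.smul_apply,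
      Matrix.sub_apply, vecMulVec_apply, Pi.single_apply,
      smul_eq_mul, mul_sub, Finset.sum_sub_distrib, mul_ite, mul_one, mul_zero,
      Finset.sum_ite_eq, Finset.mem_univ, if_true, Finset.sum_ite_irrel,
      Finset.sum_const_zero, hanti k l]
    ring
  rw [hsum]
  exact sum_mem fun i _ => sum_mem fun j _ =>
    Submodule.smul_mem _ _ (Submodule.subset_span ⟨_, _, rfl⟩)

lemma dotProduct_pfaffPolar_vecWedge (a p q r s : Fin 5 → ℝ) :
    a ⬝ᵥ pfaffPolar (vecWedge p q) (vecWedge r s) = (of ![a, p, q, r, s]).det := by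
  simp [pfaffPolar, vecWedge, vecMulVec_apply, dotProduct, det_succ_row_zero, Fin.sum_univ_succ,
    Fin.succAbove]
  ring

lemma mulVec_dotProduct_pfaffPolar_vecWedge (A : Matrix (Fin 5) (Fin 5) ℝ)
    (a p q r s : Fin 5 → ℝ) :
    (A *ᵥ a) ⬝ᵥ pfaffPolar (A * vecWedge p q * Aᵀ) (A * vecWedge r s * Aᵀ) =
      A.det * (a ⬝ᵥ pfaffPolar (vecWedge p q) (vecWedge r s)) := by
  have hrows : of ![A *ᵥ a, A *ᵥ p, A *ᵥ q, A *ᵥ r, A *ᵥ s] = of ![a, p, q, r, s] * Aᵀ := by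
    ext i j
    rw [mul_apply_eq_vecMul, vecMul_transpose]
    fin_cases i <;> rfl
  simp only [mul_vecWedge_mul_transpose, dotProduct_pfaffPolar_vecWedge, hrows, det_mul,
    det_transpose, mul_comm]

lemma mulVec_dotProduct_pfaffPolar (A : Matrix (Fin 5) (Fin 5) ℝ) (a : Fin 5 → ℝ)
    {u v : Matrix (Fin 5) (Fin 5) ℝ} (hu : uᵀ = -u) (hv : vᵀ = -v) :
    (A *ᵥ a) ⬝ᵥ pfaffPolar (A * u * Aᵀ) (A * v * Aᵀ) = A.det * (a ⬝ᵥ pfaffPolar u v) := by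
  replace hu := mem_span_vecWedge hu
  replace hv := mem_span_vecWedge hv
  induction hu using Submodule.span_induction with
  | zero => simp
  | add x y _ _ hx hy => simp [mul_add, add_mul, hx, hy]
  | smul c x _ hx => simp [hx, mul_left_comm]
  | mem u hu =>
    induction hv using Submodule.span_induction with
    | zero => simp
    | add x y _ _ hx hy => simp [mul_add, add_mul, hx, hy]
    | smul c x _ hx => simp [hx, mul_left_comm]
    | mem v hv =>
      obtain ⟨p, q, rfl⟩ := hu
      obtain ⟨r, s, rfl⟩ := hv
      exact mulVec_dotProduct_pfaffPolar_vecWedge A a p q r s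

lemma pfaff_apply (x : altTensor) (m : Fin 5) (s t : Fin 3) :
    pfaff x m s t = (1 / 2) * pfaffPolar (x.1 s) (x.1 t) m := by
  fin_cases m <;> simp [pfaff, pfaffMinor, symProd, coeffV2, vecMulVec_apply, pfaffPolar] <;> ring

lemma phi1_apply (x : altTensor) (a : Fin 5 → ℝ) (s t : Fin 3) :
    phi1 x a s t = (1 / 2) * (a ⬝ᵥ pfaffPolar (x.1 s) (x.1 t)) := by
  simp only [phi1, LinearMap.sum_apply, LinearMap.smulRight_apply, LinearMap.proj_apply,
    Matrix.sum_apply, Matrix.smul_apply, pfaff_apply, dotProduct, Finset.mul_sum, smul_eq_mul,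
    mul_left_comm]

lemma phi1_single (x : altTensor) (m : Fin 5) : phi1 x (Pi.single m 1) = pfaff x m := by
  ext s t
  rw [phi1_apply, pfaff_apply, single_one_dotProduct]

lemma smul_altTensor_apply (g : GReal) (x : altTensor) (k : Fin 3) :
    (g • x).1 k = ∑ j, (g.2 : Matrix (Fin 3) (Fin 3) ℝ) k j •
      ((g.1 : Matrix (Fin 5) (Fin 5) ℝ) * x.1 j * (g.1 : Matrix (Fin 5) (Fin 5) ℝ)ᵀ) := rfl

lemma phi1_smul (g : GReal) (x : altTensor) (a : Fin 5 → ℝ) :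
    phi1 (g • x) ((g.1 : Matrix (Fin 5) (Fin 5) ℝ) *ᵥ a) =
      (g.1 : Matrix (Fin 5) (Fin 5) ℝ).det •
        ((g.2 : Matrix (Fin 3) (Fin 3) ℝ) * phi1 x a * (g.2 : Matrix (Fin 3) (Fin 3) ℝ)ᵀ) := by
  ext s t
  simp only [phi1_apply, smul_altTensor_apply, map_sum, map_smul, LinearMap.sum_apply,
    LinearMap.smul_apply, dotProduct_sum, dotProduct_smul, mulVec_dotProduct_pfaffPolar _ _ (x.2 _)
    (x.2 _), Matrix.smul_apply, Matrix.mul_apply, transpose_apply, smul_eq_mul, Finset.mul_sum,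
    Finset.sum_mul]
  exact Finset.sum_congr rfl fun k _ => Finset.sum_congr rfl fun j _ => by ring

lemma transpose_pfaff (x : altTensor) (m : Fin 5) : (pfaff x m)ᵀ = pfaff x m := by
  ext s t
  rw [transpose_apply, pfaff_apply, pfaff_apply]
  fin_cases m <;> simp [pfaffPolar] <;> ring

end Pfaffians

section EquivariantForms

/-- `symCoords` as a linear map. -/
def symCoordsLin : Matrix (Fin 3) (Fin 3) ℝ →ₗ[ℝ] Fin 6 → ℝ where
  toFun := symCoords
  map_add' p q := by
    ext i
    fin_cases i <;> simp [symCoords] <;> ring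
  map_smul' c p := by
    ext i
    fin_cases i <;> simp [symCoords] <;> ring

/-- The section of `symCoords` with values in the symmetric matrices. -/
noncomputable def symOfCoords : (Fin 6 → ℝ) →ₗ[ℝ] Matrix (Fin 3) (Fin 3) ℝ where
  toFun v := !![v 0, v 3 / 2, v 5 / 2; v 3 / 2, v 1, v 4 / 2; v 5 / 2, v 4 / 2, v 2]
  map_add' p q := by
    ext i j
    fin_cases i <;> fin_cases j <;> simp <;> ring
  map_smul' c p := by
    ext i j
    fin_cases i <;> fin_cases j <;> simp <;> ring

lemma symCoordsLin_symOfCoords (v : Fin 6 → ℝ) : symCoordsLin (symOfCoords v) = v := by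
  ext i
  fin_cases i <;> simp [symOfCoords, symCoordsLin, symCoords] <;> ring

lemma transpose_symOfCoords (v : Fin 6 → ℝ) : (symOfCoords v)ᵀ = symOfCoords v := by
  ext i j
  fin_cases i <;> fin_cases j <;> simp [symOfCoords]

lemma symOfCoords_symCoordsLin {q : Matrix (Fin 3) (Fin 3) ℝ} (hq : qᵀ = q) :
    symOfCoords (symCoordsLin q) = q := by
  have hsymm (i j) : q i j = q j i := congrFun₂ hq j i
  ext i j
  fin_cases i <;> fin_cases j <;>
    simp [symOfCoords, symCoordsLin, symCoords, hsymm 1 0, hsymm 2 0, hsymm 2 1]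

/-- The action of `B` on `Sym² V₂` in the coordinates `symCoords`. -/
noncomputable def symSquare (B : Matrix (Fin 3) (Fin 3) ℝ) : (Fin 6 → ℝ) →ₗ[ℝ] Fin 6 → ℝ :=
  symCoordsLin ∘ₗ (LinearMap.mulRight ℝ Bᵀ ∘ₗ LinearMap.mulLeft ℝ B) ∘ₗ symOfCoords

lemma symSquare_symCoordsLin (B : Matrix (Fin 3) (Fin 3) ℝ) {q : Matrix (Fin 3) (Fin 3) ℝ}
    (hq : qᵀ = q) : symSquare B (symCoordsLin q) = symCoordsLin (B * q * Bᵀ) := by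
  simp [symSquare, symOfCoords_symCoordsLin hq]

lemma symSquare_comp (B C : Matrix (Fin 3) (Fin 3) ℝ) :
    symSquare B ∘ₗ symSquare C = symSquare (B * C) := by
  refine LinearMap.ext fun v => ?_
  have hsymm : (C * symOfCoords v * Cᵀ)ᵀ = C * symOfCoords v * Cᵀ := by
    simp [transpose_symOfCoords, Matrix.mul_assoc]
  have h := symSquare_symCoordsLin B hsymm
  simpa [symSquare, Matrix.mul_assoc] using h

lemma symSquare_one : symSquare 1 = LinearMap.id :=
  LinearMap.ext fun v => by simp [symSquare, symCoordsLin_symOfCoords]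

lemma det_symSquare_ne_zero (g : GL (Fin 3) ℝ) : LinearMap.det (symSquare g) ≠ 0 := by
  have h : symSquare g ∘ₗ symSquare (g⁻¹ : GL (Fin 3) ℝ) = LinearMap.id := by
    rw [symSquare_comp, g.mul_inv, symSquare_one]
  exact left_ne_zero_of_mul_eq_one (by rw [← LinearMap.det_comp, h, LinearMap.det_id])

/-- The volume form on `Sym² V₂` normalized on the basis `l₀², l₁², l₂², l₀l₁, l₁l₂, l₀l₂`. -/
noncomputable def symVolume : Matrix (Fin 3) (Fin 3) ℝ [⋀^Fin 6]→ₗ[ℝ] ℝ :=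
  (Pi.basisFun ℝ (Fin 6)).det.compLinearMap symCoordsLin

lemma symVolume_conj (B : Matrix (Fin 3) (Fin 3) ℝ) {q : Fin 6 → Matrix (Fin 3) (Fin 3) ℝ}
    (hq : ∀ i, (q i)ᵀ = q i) :
    symVolume (fun i => B * q i * Bᵀ) = LinearMap.det (symSquare B) * symVolume q := by
  rw [symVolume, AlternatingMap.compLinearMap_apply, AlternatingMap.compLinearMap_apply]
  simp only [← symSquare_symCoordsLin B (hq _)]
  exact Module.Basis.det_comp _ _ _

lemma alternatingMap_matrix_smul {ι R M : Type*} [Fintype ι] [DecidableEq ι] [CommRing R]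
    [AddCommGroup M] [Module R M] (f : M [⋀^ι]→ₗ[R] R) (A : Matrix ι ι R) (v : ι → M) :
    f (fun i => ∑ j, A i j • v j) = A.det * f v := by
  have h := (f.compLinearMap (Fintype.linearCombination R v)).eq_smul_basis_det (Pi.basisFun R ι)
  have hA := DFunLike.congr_fun h fun i => A i
  simp only [AlternatingMap.smul_apply, AlternatingMap.compLinearMap_apply, Pi.basisFun_apply,
    Fintype.linearCombination_apply, Pi.single_apply, ite_smul, one_smul, zero_smul,
    Finset.sum_ite_eq', Finset.mem_univ, if_true, Pi.basisFun_det_apply, smul_eq_mul] at hA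
  exact hA.trans (mul_comm _ _)

/-- `q ↦ q ∧ Pfaff₀(x) ∧ ⋯ ∧ Pfaff₄(x)`, as a linear functional on `Sym² V₂`. -/
noncomputable def pfaffFunctional (x : altTensor) : Matrix (Fin 3) (Fin 3) ℝ →ₗ[ℝ] ℝ where
  toFun q := symVolume (vecCons q (pfaff x))
  map_add' := symVolume.map_vecCons_add (pfaff x)
  map_smul' := symVolume.map_vecCons_smul (pfaff x)

lemma pfaffFunctional_apply (x : altTensor) (q : Matrix (Fin 3) (Fin 3) ℝ) :
    pfaffFunctional x q = symVolume (vecCons q (pfaff x)) := rfl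

lemma Phi1_apply (x : altTensor) (s t : Fin 3) : Phi1 x s t =
    (1 / 3 ^ 4 : ℝ) * pfaffFunctional x (symProd (Pi.single s 1) (Pi.single t 1)) := by
  rw [Phi1, of_apply]
  congr 1
  rw [pfaffFunctional_apply, symVolume, AlternatingMap.compLinearMap_apply, Pi.basisFun_det_apply]
  congr 2
  funext i
  fin_cases i <;> rfl

lemma symProd_eq_sum (a b : Fin 3 → ℝ) : symProd a b =
    ∑ s, ∑ t, (a s * b t) • symProd (Pi.single s 1) (Pi.single t 1) := by
  ext i j
  simp only [symProd, Matrix.sum_apply, Matrix.smul_apply, Matrix.add_apply, vecMulVec_apply,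
    Pi.single_apply, smul_eq_mul, mul_add, Finset.sum_add_distrib, mul_ite, mul_one, mul_zero,
    Finset.sum_ite_eq, Finset.mem_univ, if_true, Finset.sum_ite_irrel, Finset.sum_const_zero]
  ring

lemma dotProduct_Phi1_mulVec (x : altTensor) (a b : Fin 3 → ℝ) :
    a ⬝ᵥ (Phi1 x *ᵥ b) = (1 / 3 ^ 4 : ℝ) * pfaffFunctional x (symProd a b) := by
  rw [symProd_eq_sum a b]
  simp only [dotProduct, mulVec, Phi1_apply, map_sum, map_smul, smul_eq_mul, Finset.mul_sum]
  exact Finset.sum_congr rfl fun s _ => Finset.sum_congr rfl fun t _ => by ring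

lemma transpose_symProd (a b : Fin 3 → ℝ) : (symProd a b)ᵀ = symProd a b := by
  simp [symProd, transpose_vecMulVec, add_comm]

lemma mul_symProd_mul_transpose (B : Matrix (Fin 3) (Fin 3) ℝ) (a b : Fin 3 → ℝ) :
    B * symProd a b * Bᵀ = symProd (B *ᵥ a) (B *ᵥ b) := by
  simp only [symProd, mul_smul_comm, smul_mul_assoc, mul_add, add_mul, mul_vecMulVec,
    vecMulVec_mul, vecMul_transpose]

lemma sum_smul_pfaff_smul (g : GReal) (x : altTensor) (m : Fin 5) :
    ∑ p, (g.1 : Matrix (Fin 5) (Fin 5) ℝ)ᵀ m p • pfaff (g • x) p =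
      (g.1 : Matrix (Fin 5) (Fin 5) ℝ).det •
        ((g.2 : Matrix (Fin 3) (Fin 3) ℝ) * pfaff x m * (g.2 : Matrix (Fin 3) (Fin 3) ℝ)ᵀ) := by
  rw [← phi1_single, ← phi1_smul]
  simp [phi1]

lemma exists_pfaffFunctional_smul (g : GReal) (x : altTensor) : ∃ c : ℝ, c ≠ 0 ∧
    ∀ q : Matrix (Fin 3) (Fin 3) ℝ, qᵀ = q → pfaffFunctional (g • x)
      ((g.2 : Matrix (Fin 3) (Fin 3) ℝ) * q * (g.2 : Matrix (Fin 3) (Fin 3) ℝ)ᵀ) =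
        c * pfaffFunctional x q := by
  set A := (g.1 : Matrix (Fin 5) (Fin 5) ℝ)
  set B := (g.2 : Matrix (Fin 3) (Fin 3) ℝ)
  have hA : A.det ≠ 0 := ((Matrix.isUnit_iff_isUnit_det _).1 g.1.isUnit).ne_zero
  refine ⟨A.det ^ 4 * LinearMap.det (symSquare B),
    mul_ne_zero (pow_ne_zero _ hA) (det_symSquare_ne_zero g.2), fun q hq => ?_⟩
  have hcons : vecCons (B * q * Bᵀ) (fun m => B * pfaff x m * Bᵀ) =
      fun i => B * vecCons q (pfaff x) i * Bᵀ := by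
    funext i
    refine Fin.cases rfl (fun _ => rfl) i
  have hsymm (i) : (vecCons q (pfaff x) i)ᵀ = vecCons q (pfaff x) i :=
    Fin.cases hq (transpose_pfaff x) i
  have hsum (m) : ∑ p, Aᵀ m p • pfaff (g • x) p = A.det • (B * pfaff x m * Bᵀ) :=
    sum_smul_pfaff_smul g x m
  refine mul_left_cancel₀ hA ?_
  calc A.det * pfaffFunctional (g • x) (B * q * Bᵀ)
    _ = symVolume.curryLeft (B * q * Bᵀ) fun m => ∑ p, Aᵀ m p • pfaff (g • x) p := by
      rw [alternatingMap_matrix_smul, det_transpose]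
      rfl
    _ = A.det ^ 5 * symVolume.curryLeft (B * q * Bᵀ) fun m => B * pfaff x m * Bᵀ := by
      simp only [hsum]
      exact (AlternatingMap.map_smul_univ _ (fun _ => A.det) _).trans (by simp)
    _ = A.det ^ 5 * (LinearMap.det (symSquare B) * pfaffFunctional x q) := by
      rw [AlternatingMap.curryLeft_apply_apply, hcons, symVolume_conj B hsymm,
        pfaffFunctional_apply]
    _ = A.det * (A.det ^ 4 * LinearMap.det (symSquare B) * pfaffFunctional x q) := by ring

lemma exists_Phi1_smul (g : GReal) (x : altTensor) : ∃ c : ℝ, c ≠ 0 ∧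
    (g.2 : Matrix (Fin 3) (Fin 3) ℝ)ᵀ * Phi1 (g • x) * (g.2 : Matrix (Fin 3) (Fin 3) ℝ) =
      c • Phi1 x := by
  obtain ⟨c, hc, h⟩ := exists_pfaffFunctional_smul g x
  refine ⟨c, hc, ?_⟩
  ext s t
  set B := (g.2 : Matrix (Fin 3) (Fin 3) ℝ)
  calc (Bᵀ * Phi1 (g • x) * B) s t
    _ = (B *ᵥ Pi.single s 1) ⬝ᵥ (Phi1 (g • x) *ᵥ (B *ᵥ Pi.single t 1)) := by
      simp only [mulVec_single_one, Matrix.mul_assoc]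
      rfl
    _ = c * Phi1 x s t := by
      rw [dotProduct_Phi1_mulVec, ← mul_symProd_mul_transpose, h _ (transpose_symProd _ _),
        Phi1_apply, mul_left_comm]

lemma Phi2_apply (x : altTensor) (a : Fin 5 → ℝ) :
    Phi2 x a = ((phi1 x a * Phi1 x) * (phi1 x a * Phi1 x)).trace := rfl

lemma exists_Phi2_smul (g : GReal) (x : altTensor) : ∃ c : ℝ, c ≠ 0 ∧ ∀ a : Fin 5 → ℝ,
    Phi2 (g • x) ((g.1 : Matrix (Fin 5) (Fin 5) ℝ) *ᵥ a) = c * Phi2 x a := by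
  obtain ⟨c, hc, h⟩ := exists_Phi1_smul g x
  have hdet : (g.1 : Matrix (Fin 5) (Fin 5) ℝ).det ≠ 0 :=
    ((Matrix.isUnit_iff_isUnit_det _).1 g.1.isUnit).ne_zero
  refine ⟨(_ * c) ^ 2, pow_ne_zero _ (mul_ne_zero hdet hc), fun a => ?_⟩
  have hconj : phi1 (g • x) ((g.1 : Matrix (Fin 5) (Fin 5) ℝ) *ᵥ a) * Phi1 (g • x) =
      ((g.1 : Matrix (Fin 5) (Fin 5) ℝ).det * c) • ((g.2 : Matrix (Fin 3) (Fin 3) ℝ) *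
        (phi1 x a * Phi1 x) * (g.2⁻¹ : GL (Fin 3) ℝ)) := by
    rw [← Units.mul_left_inj g.2]
    simp only [phi1_smul, smul_mul_assoc, Matrix.mul_assoc, Units.inv_mul, Matrix.mul_one]
    rw [← Matrix.mul_assoc _ᵀ, h]
    simp only [mul_smul_comm, smul_smul]
  rw [Phi2_apply, Phi2_apply, hconj, smul_mul_smul_comm, trace_smul, smul_eq_mul, ← pow_two]
  congr 1
  simpa only [← pow_two, Units.conj_pow] using trace_units_conj g.2 ((phi1 x a * Phi1 x) ^ 2)

end EquivariantForms

section BasePoint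

lemma basePoint_zero : basePoint.1 0 = !![0, 0, 0, 0, 0; 0, 0, 0, 0, 1; 0, 0, 0, -3, 0;
    0, 0, 3, 0, 0; 0, -1, 0, 0, 0] := by
  ext i j
  fin_cases i <;> fin_cases j <;> simp [basePoint, wedge]

lemma basePoint_one : basePoint.1 1 = !![0, 0, 0, 0, -1; 0, 0, 0, 2, 0; 0, 0, 0, 0, 0;
    0, -2, 0, 0, 0; 1, 0, 0, 0, 0] := by
  ext i j
  fin_cases i <;> fin_cases j <;> simp [basePoint, wedge]

lemma basePoint_two : basePoint.1 2 = !![0, 0, 0, 1, 0; 0, 0, -3, 0, 0; 0, 3, 0, 0, 0;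
    -1, 0, 0, 0, 0; 0, 0, 0, 0, 0] := by
  ext i j
  fin_cases i <;> fin_cases j <;> simp [basePoint, wedge]

lemma phi1_basePoint (a : Fin 5 → ℝ) : phi1 basePoint a =
    !![-3 * a 0, -3 / 2 * a 1, -1 / 2 * a 2; -3 / 2 * a 1, -2 * a 2, -3 / 2 * a 3;
      -1 / 2 * a 2, -3 / 2 * a 3, -3 * a 4] := by
  ext s t
  rw [phi1_apply]
  fin_cases s <;> fin_cases t <;>
    simp [basePoint_zero, basePoint_one, basePoint_two, pfaffPolar, dotProduct,
      Fin.sum_univ_five] <;> ring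

/-- The symmetric matrix `Φ₁(w)` of the base point `w`. -/
def baseForm3 : Matrix (Fin 3) (Fin 3) ℝ := !![0, 0, -2; 0, 1, 0; -2, 0, 0]

lemma isUnit_baseForm3 : IsUnit baseForm3 :=
  (isUnit_iff_isUnit_det _).2 (by simp [baseForm3, det_fin_three])

lemma pfaffFunctional_basePoint (q : Matrix (Fin 3) (Fin 3) ℝ) :
    pfaffFunctional basePoint q = 81 * q 1 1 - 324 * q 0 2 := by
  have hrows : (fun i => symCoords (vecCons q (pfaff basePoint) i)) =
      !![q 0 0, q 1 1, q 2 2, 2 * q 0 1, 2 * q 1 2, 2 * q 0 2; -3, 0, 0, 0, 0, 0;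
      0, 0, 0, -3, 0, 0; 0, -2, 0, 0, 0, -1; 0, 0, 0, 0, -3, 0; 0, 0, -3, 0, 0, 0] := by
    funext i
    refine Fin.cases ?_ (fun m => ?_) i
    · rfl
    · rw [cons_val_succ, ← phi1_single, phi1_basePoint]
      ext j
      fin_cases m <;> fin_cases j <;> simp [symCoords] <;> norm_num
  rw [pfaffFunctional_apply, symVolume, AlternatingMap.compLinearMap_apply, Pi.basisFun_det_apply]
  refine (congrArg det hrows).trans ?_
  simp [det_succ_row _ (1 : Fin _), Fin.sum_univ_succ, Fin.succAbove]
  ring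

lemma Phi1_basePoint : Phi1 basePoint = baseForm3 := by
  ext s t
  rw [Phi1_apply, pfaffFunctional_basePoint, baseForm3]
  fin_cases s <;> fin_cases t <;> simp [symProd, vecMulVec_apply] <;> norm_num

lemma Phi2_basePoint (a : Fin 5 → ℝ) : Phi2 basePoint a = a ⬝ᵥ baseForm5 *ᵥ a := by
  rw [Phi2_apply, Phi1_basePoint, phi1_basePoint, baseForm3, baseForm5]
  simp [trace, Fin.sum_univ_three, dotProduct, mulVec, Fin.sum_univ_five]
  ring

lemma transpose_baseForm5 : baseForm5ᵀ = baseForm5 := by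
  simp [baseForm5, ← Matrix.ext_iff, Fin.forall_fin_succ]

lemma eq_of_dotProduct_mulVec_self_eq {n K : Type*} [Fintype n] [Field K] [NeZero (2 : K)]
    {M N : Matrix n n K} (hM : M.IsSymm) (hN : N.IsSymm)
    (h : ∀ a : n → K, a ⬝ᵥ M *ᵥ a = a ⬝ᵥ N *ᵥ a) : M = N := by
  classical
  have hdiag (i) : M i i = N i i := by
    simpa only [mulVec_single_one, single_one_dotProduct, col_apply] using h (Pi.single i 1)
  ext i j
  have hij := h (Pi.single i 1 + Pi.single j 1)
  simp only [add_dotProduct, mulVec_add, dotProduct_add, mulVec_single_one, single_one_dotProduct,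
    col_apply, hdiag, hM.apply i j, hN.apply i j] at hij
  exact mul_left_cancel₀ (two_ne_zero (α := K)) (by linear_combination hij)

lemma mem_stabH3_basePoint {g : SpecialLinearGroup (Fin 5) ℝ} :
    g ∈ stabH3 basePoint ↔ g.1ᵀ * baseForm5 * g.1 = baseForm5 := by
  have hform (a) : Phi2 basePoint (g.1 *ᵥ a) = a ⬝ᵥ (g.1ᵀ * baseForm5 * g.1) *ᵥ a := by
    rw [Phi2_basePoint, ← mulVec_mulVec, ← mulVec_mulVec, dotProduct_mulVec a, vecMul_transpose]
  refine ⟨fun h => eq_of_dotProduct_mulVec_self_eq ?_ transpose_baseForm5 fun a => ?_,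
    fun h a => ?_⟩
  · rw [IsSymm, transpose_mul, transpose_mul, transpose_transpose, transpose_baseForm5,
      Matrix.mul_assoc]
  · rw [← hform, ← Phi2_basePoint]
    exact h a
  · rw [hform, h, Phi2_basePoint]

lemma mem_stabH {x : altTensor} {g : HReal} : g ∈ stabH x ↔ inclHG g • x = x := Iff.rfl

lemma transpose_mul_baseForm3_mul {g : SpecialLinearGroup (Fin 3) ℝ} (hg : g ∈ stabH2 basePoint) :
    g.1ᵀ * baseForm3 * g.1 = baseForm3 := by
  obtain ⟨h, hh, rfl⟩ := hg
  obtain ⟨c, -, hc⟩ := exists_Phi1_smul (inclHG h) basePoint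
  rw [mem_stabH.1 hh, Phi1_basePoint] at hc
  change h.2.1ᵀ * baseForm3 * h.2.1 = c • baseForm3 at hc
  have hdet : baseForm3.det ≠ 0 := ((isUnit_iff_isUnit_det _).1 isUnit_baseForm3).ne_zero
  have hcube : c ^ 3 = 1 := by
    refine mul_right_cancel₀ hdet ?_
    simpa [det_mul, det_smul, h.2.2] using (congrArg det hc).symm
  have hc1 : c = 1 := (Odd.strictMono_pow (by decide)).injective (hcube.trans (one_pow 3).symm)
  exact hc.trans (by rw [hc1, one_smul])

lemma mul_basePoint_mul_apply {g : SpecialLinearGroup (Fin 5) ℝ} (hg : g ∈ stabH1 basePoint) :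
    (g.1 * basePoint.1 0 * g.1ᵀ) 0 2 = 0 := by
  obtain ⟨h, hh, rfl⟩ := hg
  have hsplit : inclHG (h.1, 1) • basePoint = inclHG (1, h.2⁻¹) • basePoint := by
    rw [show ((h.1, 1) : HReal) = (1, h.2⁻¹) * h from Prod.ext (by simp) (by simp), map_mul,
      mul_smul, mem_stabH.1 hh]
  have hentry := congrArg (fun x : altTensor => x.1 0 0 2) hsplit
  simpa [smul_altTensor_apply, inclHG, Fin.sum_univ_three, basePoint_zero, basePoint_one,
    basePoint_two] using hentry

end BasePoint

section TensorAction

open NormedSpace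

variable {n m : Type*} [Fintype n] [Fintype m]

/-- The action of a pair of matrices on `m`-tuples of `n × n` matrices that extends
`altTensorAction` to arbitrary matrices and tensors. -/
def tensorAct (g : Matrix n n ℝ × Matrix m m ℝ) :
    (m → Matrix n n ℝ) →ₗ[ℝ] (m → Matrix n n ℝ) where
  toFun x k := ∑ j, g.2 k j • (g.1 * x j * g.1ᵀ)
  map_add' x y := by
    ext1 k
    simp [Matrix.mul_add, Matrix.add_mul, Finset.sum_add_distrib]
  map_smul' c x := by
    ext1 k
    simp [Finset.smul_sum, smul_comm c]

/-- The infinitesimal action corresponding to `tensorAct`. -/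
def tensorLieAct (X : Matrix n n ℝ × Matrix m m ℝ) (x : m → Matrix n n ℝ) : m → Matrix n n ℝ :=
  fun k => X.1 * x k + x k * X.1ᵀ + ∑ j, X.2 k j • x j

lemma tensorAct_apply (g : Matrix n n ℝ × Matrix m m ℝ) (x : m → Matrix n n ℝ) (k : m) :
    tensorAct g x k = ∑ j, g.2 k j • (g.1 * x j * g.1ᵀ) := rfl

lemma tensorAct_mul (g h : Matrix n n ℝ × Matrix m m ℝ) (x : m → Matrix n n ℝ) :
    tensorAct (g * h) x = tensorAct g (tensorAct h x) := by
  ext1 k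
  simp only [tensorAct_apply, Prod.fst_mul, Prod.snd_mul, Matrix.mul_apply (M := g.2),
    Finset.sum_smul, Matrix.mul_sum, Matrix.sum_mul, Finset.smul_sum, Matrix.mul_smul,
    Matrix.smul_mul, smul_smul, transpose_mul, Matrix.mul_assoc]
  exact Finset.sum_comm

lemma continuous_tensorAct (x : m → Matrix n n ℝ) :
    Continuous fun g : Matrix n n ℝ × Matrix m m ℝ => tensorAct g x := by
  refine continuous_pi fun k => ?_
  simp only [tensorAct_apply]
  fun_prop

lemma tensorLieAct_smul (c : ℝ) (X : Matrix n n ℝ × Matrix m m ℝ) (x : m → Matrix n n ℝ) :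
    tensorLieAct (c • X) x = c • tensorLieAct X x := by
  ext1 k
  simp [tensorLieAct, Finset.smul_sum, smul_smul]

variable [DecidableEq n]

attribute [local instance] Matrix.linftyOpNormedRing Matrix.linftyOpNormedAlgebra

lemma hasDerivAt_exp_smul_mul_mul_transpose (X M : Matrix n n ℝ) :
    HasDerivAt (fun t : ℝ => exp (t • X) * M * (exp (t • X))ᵀ) (X * M + M * Xᵀ) 0 := by
  have htranspose : HasDerivAt (fun t : ℝ => (exp (t • X))ᵀ) Xᵀ 0 :=
    (LinearMap.toContinuousLinearMap (transposeLinearEquiv n n ℝ ℝ).toLinearMap).hasFDerivAt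
      |>.comp_hasDerivAt 0 (hasDerivAt_exp_smul_zero X)
  have hd := ((hasDerivAt_exp_smul_zero X).mul_const M).mul htranspose
  simp only [zero_smul, exp_zero, transpose_one, mul_one, one_mul] at hd
  exact hd

variable [DecidableEq m]

lemma tensorAct_one (x : m → Matrix n n ℝ) :
    tensorAct (1 : Matrix n n ℝ × Matrix m m ℝ) x = x := by
  ext1 k
  simp [tensorAct_apply, one_apply]

lemma hasDerivAt_tensorAct (X : Matrix n n ℝ × Matrix m m ℝ) (x : m → Matrix n n ℝ) :
    HasDerivAt (fun t : ℝ => tensorAct (exp (t • X)) x) (tensorLieAct X x) 0 := by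
  refine hasDerivAt_pi.2 fun k => ?_
  have hentry (j : m) : HasDerivAt (fun t : ℝ => exp (t • X.2) k j) (X.2 k j) 0 :=
    hasDerivAt_pi.1 (hasDerivAt_pi.1 (hasDerivAt_exp_smul_zero X.2) k) j
  have hsum := HasDerivAt.fun_sum (u := Finset.univ) fun j _ =>
    (hentry j).smul (hasDerivAt_exp_smul_mul_mul_transpose X.1 (x j))
  convert hsum using 1
  · funext t
    rw [tensorAct_apply, show exp (t • X) = _ from exp_prodMk (t • X.1) (t • X.2)]
    rfl
  · simp [tensorLieAct, one_apply, Finset.sum_add_distrib]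

end TensorAction

section StabilizerLie

open NormedSpace Topology LieAlgebra.SpecialLinear

attribute [local instance] Matrix.linftyOpNormedRing Matrix.linftyOpNormedAlgebra
attribute [local instance 100] LieRing.ofAssociativeRing

variable {n : Type*} [Fintype n] [DecidableEq n]

lemma hasDerivAt_transpose_exp_smul_mul_mul (X J : Matrix n n ℝ) :
    HasDerivAt (fun t : ℝ => (exp (t • X))ᵀ * J * exp (t • X)) (Xᵀ * J + J * X) 0 := by
  simpa only [← transpose_smul, Matrix.exp_transpose, transpose_transpose] using
    hasDerivAt_exp_smul_mul_mul_transpose Xᵀ J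

lemma transpose_exp_mul_mul_exp {J X : Matrix n n ℝ}
    (hX : X ∈ skewAdjointMatricesLieSubalgebra J) : (exp X)ᵀ * J * exp X = J := by
  let := NormedAlgebra.restrictScalars ℚ ℝ (Matrix n n ℝ)
  have hskew : Xᵀ * J = J * -X := (mem_skewAdjointMatricesSubmodule J X).1 hX
  have hsemi : SemiconjBy J X (-Xᵀ) := by
    rw [SemiconjBy, Matrix.neg_mul, hskew, Matrix.mul_neg, neg_neg]
  have hexp := hsemi.exp_neg_mul_mul_exp_eq_self
  rw [neg_neg] at hexp
  rw [← Matrix.exp_transpose]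
  exact hexp

lemma mem_skewAdjointMatricesLieSubalgebra_of_mem_lieSet
    {K : Subgroup (SpecialLinearGroup n ℝ)} {J X : Matrix n n ℝ}
    (hK : ∀ g ∈ K, g.1ᵀ * J * g.1 = J)
    (hX : X ∈ lieSet SpecialLinearGroup.coeMonoidHom K.topologicalClosure) :
    X ∈ skewAdjointMatricesLieSubalgebra J := by
  refine (mem_skewAdjointMatricesSubmodule J X).2 ?_
  have hzero := eq_zero_of_mem_lieSet_topologicalClosure (E := Matrix n n ℝ)
    continuous_subtype_val (f := fun g => gᵀ * J * g)
    (by fun_prop) hK hX (hasDerivAt_transpose_exp_smul_mul_mul X J)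
  rw [Matrix.IsSkewAdjoint, IsAdjointPair, Matrix.mul_neg]
  exact eq_neg_of_add_eq_zero_left hzero

lemma mem_sl_of_mem_lieSet {K : Subgroup (SpecialLinearGroup n ℝ)} {X : Matrix n n ℝ}
    (hX : X ∈ lieSet SpecialLinearGroup.coeMonoidHom K) : X ∈ sl n ℝ := by
  rw [← SetLike.mem_coe, ← lieSet_top_eq_sl]
  exact lieSet_mono le_top hX

lemma mem_stabH_iff_tensorAct_eq {x : altTensor} {g : HReal} :
    g ∈ stabH x ↔ tensorAct (pairHom _ _ g) x.1 = x.1 :=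
  mem_stabH.trans Subtype.ext_iff

lemma isClosed_stabH (x : altTensor) : IsClosed (stabH x : Set HReal) := by
  rw [show (stabH x : Set HReal) = {g | tensorAct (pairHom _ _ g) x.1 = x.1} from
    Set.ext fun _ => mem_stabH_iff_tensorAct_eq]
  exact isClosed_eq ((continuous_tensorAct x.1).comp isClosedEmbedding_pairHom.continuous)
    continuous_const

lemma tensorAct_exp_eq_self {m : Type*} [Fintype m] [DecidableEq m]
    {X : Matrix n n ℝ × Matrix m m ℝ} {x : m → Matrix n n ℝ}
    (h : tensorLieAct X x = 0) : tensorAct (exp X) x = x := by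
  have hconst := eq_of_hasDerivAt_zero_of_flow (γ := fun t : ℝ => tensorAct (exp (t • X)) x)
    (h ▸ hasDerivAt_tensorAct X x)
    (fun s => ⟨(tensorAct (exp (s • X))).toContinuousLinearMap, fun t =>
      (congrArg (tensorAct · x) (exp_add_smul s t X)).trans (tensorAct_mul _ _ x)⟩) 1
  simpa [tensorAct_one] using hconst

lemma tensorLieAct_eq_zero_of_mem_lieSet {x : altTensor}
    {X : Matrix (Fin 5) (Fin 5) ℝ × Matrix (Fin 3) (Fin 3) ℝ}
    (hX : X ∈ lieSet (pairHom _ _) (stabH x)) : tensorLieAct X x.1 = 0 :=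
  eq_zero_of_mem_lieSet_topologicalClosure isClosedEmbedding_pairHom.continuous
    (continuous_tensorAct x.1) (fun _ => mem_stabH_iff_tensorAct_eq.1)
    (lieSet_mono (Subgroup.le_topologicalClosure _) hX) (hasDerivAt_tensorAct X x.1)

lemma mem_lieSet_stabH {x : altTensor} {X : Matrix (Fin 5) (Fin 5) ℝ × Matrix (Fin 3) (Fin 3) ℝ}
    (h₁ : X.1.trace = 0) (h₂ : X.2.trace = 0) (h : tensorLieAct X x.1 = 0) :
    X ∈ lieSet (pairHom _ _) (stabH x) := fun t => by
  have hexp : exp (t • X) = (exp (t • X.1), exp (t • X.2)) := exp_prodMk _ _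
  refine ⟨(⟨exp (t • X.1), det_exp_eq_one (by rw [trace_smul, h₁, smul_zero])⟩,
    ⟨exp (t • X.2), det_exp_eq_one (by rw [trace_smul, h₂, smul_zero])⟩), ?_, hexp.symm⟩
  refine mem_stabH_iff_tensorAct_eq.2 ((congrArg (tensorAct · x.1) hexp.symm).trans ?_)
  exact tensorAct_exp_eq_self (by rw [tensorLieAct_smul, h, smul_zero])

end StabilizerLie

section BasePointLie

open NormedSpace Topology LieAlgebra.SpecialLinear

attribute [local instance] Matrix.linftyOpNormedRing Matrix.linftyOpNormedAlgebra
attribute [local instance 100] LieRing.ofAssociativeRing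

lemma tensorLieAct_apply {n m : Type*} [Fintype n] [Fintype m] (X : Matrix n n ℝ × Matrix m m ℝ)
    (x : m → Matrix n n ℝ) (k : m) (i j : n) : tensorLieAct X x k i j =
      ∑ l, X.1 i l * x k l j + ∑ l, x k i l * X.1 j l + ∑ l, X.2 k l * x l i j := by
  simp [tensorLieAct, mul_apply, Matrix.sum_apply]

lemma tensorLieAct_raise_basePoint : tensorLieAct (raise5, raise3) basePoint.1 = 0 := by
  ext k i j
  rw [tensorLieAct_apply]
  fin_cases k <;> fin_cases i <;> fin_cases j <;>
    simp [Fin.sum_univ_five, Fin.sum_univ_three, basePoint_zero, basePoint_one, basePoint_two,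
      raise5, raise3] <;> norm_num

lemma tensorLieAct_lower_basePoint : tensorLieAct (lower5, lower3) basePoint.1 = 0 := by
  ext k i j
  rw [tensorLieAct_apply]
  fin_cases k <;> fin_cases i <;> fin_cases j <;>
    simp [Fin.sum_univ_five, Fin.sum_univ_three, basePoint_zero, basePoint_one, basePoint_two,
      lower5, lower3] <;> norm_num

lemma toLieSubalgebra_subset_lieSet_stabH :
    (isSl2Triple_five_three.toLieSubalgebra ℝ : Set _) ⊆
      lieSet (pairHom (Fin 5) (Fin 3)) (stabH basePoint) := by
  let N : LieSubalgebra ℝ (Matrix (Fin 5) (Fin 5) ℝ × Matrix (Fin 3) (Fin 3) ℝ) :=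
    lieSubalgebra (pairHom (Fin 5) (Fin 3)) (stabH basePoint)
      (isClosedEmbedding_pairHom.isClosedMap _ (isClosed_stabH basePoint))
  exact toLieSubalgebra_le isSl2Triple_five_three (N := N)
    (mem_lieSet_stabH (by simp [raise5, trace, Fin.sum_univ_five])
      (by simp [raise3, trace, Fin.sum_univ_three]) tensorLieAct_raise_basePoint)
    (mem_lieSet_stabH (by simp [lower5, trace, Fin.sum_univ_five])
      (by simp [lower3, trace, Fin.sum_univ_three]) tensorLieAct_lower_basePoint)

lemma raise5_prodMk_zero_notMem_lieSet_stabH :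
    (raise5, 0) ∉ lieSet (pairHom (Fin 5) (Fin 3)) (stabH basePoint) := fun h => by
  have hentry := congrFun₂ (congrFun (tensorLieAct_eq_zero_of_mem_lieSet h) 0) 0 4
  rw [tensorLieAct_apply] at hentry
  simp [Fin.sum_univ_five, basePoint_zero, raise5] at hentry

theorem idComp_stabH_basePoint : idComp (stabH basePoint) =
    expGroup (pairHom (Fin 5) (Fin 3)) (isSl2Triple_five_three.toLieSubalgebra ℝ : Set _) := by
  have hclosed := isClosed_stabH basePoint
  let N : LieSubalgebra ℝ (Matrix (Fin 5) (Fin 5) ℝ × Matrix (Fin 3) (Fin 3) ℝ) :=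
    lieSubalgebra (pairHom (Fin 5) (Fin 3)) (stabH basePoint)
      (isClosedEmbedding_pairHom.isClosedMap _ hclosed)
  have hle : isSl2Triple_five_three.toLieSubalgebra ℝ ≤ N := toLieSubalgebra_subset_lieSet_stabH
  refine idComp_eq_expGroup isClosedEmbedding_pairHom hle fun X hX => ?_
  rw [show (stabH basePoint).topologicalClosure = stabH basePoint from
    SetLike.coe_injective hclosed.closure_eq] at hX
  rcases eq_toLieSubalgebra_or_raise5_mem_comap_inl (N := N)
    (fun Y hY => fst_mem_sl_and_snd_mem_sl hY) (hle (nilpositive_mem_toLieSubalgebra _))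
    (hle (nilnegative_mem_toLieSubalgebra _)) with hN | hraise
  · exact hN.le hX
  · exact absurd hraise raise5_prodMk_zero_notMem_lieSet_stabH

end BasePointLie

section BasePointProjections

open NormedSpace Topology LieAlgebra.SpecialLinear

attribute [local instance] Matrix.linftyOpNormedRing Matrix.linftyOpNormedAlgebra
attribute [local instance 100] LieRing.ofAssociativeRing

lemma toLieSubalgebra_subset_lieSet_stabH1 : (isSl2Triple_five.toLieSubalgebra ℝ : Set _) ⊆
    lieSet SpecialLinearGroup.coeMonoidHom (stabH1 basePoint) := by
  intro X hX
  obtain ⟨c₁, c₂, c₃, rfl⟩ := IsSl2Triple.mem_toLieSubalgebra_iff.1 hX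
  exact fst_mem_lieSet (toLieSubalgebra_subset_lieSet_stabH
    (IsSl2Triple.mem_toLieSubalgebra_iff.2 ⟨c₁, c₂, c₃, rfl⟩))

lemma toLieSubalgebra_subset_lieSet_stabH2 : (isSl2Triple_three.toLieSubalgebra ℝ : Set _) ⊆
    lieSet SpecialLinearGroup.coeMonoidHom (stabH2 basePoint) := by
  intro X hX
  obtain ⟨c₁, c₂, c₃, rfl⟩ := IsSl2Triple.mem_toLieSubalgebra_iff.1 hX
  exact snd_mem_lieSet (toLieSubalgebra_subset_lieSet_stabH
    (IsSl2Triple.mem_toLieSubalgebra_iff.2 ⟨c₁, c₂, c₃, rfl⟩))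

lemma raise5_pow_three_notMem_lieSet_stabH1 : raise5 ^ 3 ∉
    lieSet SpecialLinearGroup.coeMonoidHom (stabH1 basePoint).topologicalClosure := fun h => by
  have hentry := eq_zero_of_mem_lieSet_topologicalClosure (E := ℝ) (c := 0)
    continuous_subtype_val (f := fun g => (g * basePoint.1 0 * gᵀ) 0 2) (by fun_prop)
    (fun g hg => mul_basePoint_mul_apply hg) h
    (hasDerivAt_pi.1 (hasDerivAt_pi.1
      (hasDerivAt_exp_smul_mul_mul_transpose (raise5 ^ 3) (basePoint.1 0)) 0) 2)
  simp [raise5, pow_succ, basePoint_zero, vecMul, dotProduct, Fin.sum_univ_five] at hentry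

theorem idComp_stabH1_basePoint : idComp (stabH1 basePoint) =
    expGroup SpecialLinearGroup.coeMonoidHom (isSl2Triple_five.toLieSubalgebra ℝ : Set _) := by
  have hι := isClosedEmbedding_coeMonoidHom (n := Fin 5)
  let N : LieSubalgebra ℝ (Matrix (Fin 5) (Fin 5) ℝ) :=
    lieSubalgebra SpecialLinearGroup.coeMonoidHom (stabH1 basePoint).topologicalClosure
      (hι.isClosedMap _ (Subgroup.isClosed_topologicalClosure _))
  have hle : isSl2Triple_five.toLieSubalgebra ℝ ≤ N := fun X hX =>
    lieSet_mono (Subgroup.le_topologicalClosure _) (toLieSubalgebra_subset_lieSet_stabH1 hX)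
  have hnot : raise5 ^ 3 ∉ N := raise5_pow_three_notMem_lieSet_stabH1
  refine idComp_eq_expGroup hι toLieSubalgebra_subset_lieSet_stabH1 fun X hX => ?_
  rcases eq_of_mem_five (N := N) (fun Y hY => mem_sl_of_mem_lieSet hY)
    (hle (nilpositive_mem_toLieSubalgebra _)) (hle (nilnegative_mem_toLieSubalgebra _)) with
    hN | hN | hN
  · exact hN.le hX
  · exact absurd (hN.ge ((pow_mem_skewAdjointMatricesLieSubalgebra_iff isUnit_baseForm5
      raise5_mem_skewAdjoint (raise5_pow_ne_zero (by decide))).2 (by decide))) hnot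
  · exact absurd (hN.ge (mem_sl_iff.2 (trace_pow_eq_zero isSl2Triple_five three_ne_zero))) hnot

lemma raise3_pow_two_notMem_lieSet_stabH2 : raise3 ^ 2 ∉
    lieSet SpecialLinearGroup.coeMonoidHom (stabH2 basePoint).topologicalClosure := fun h => by
  have hso {X : Matrix (Fin 3) (Fin 3) ℝ} (hX : X ∈ lieSet SpecialLinearGroup.coeMonoidHom
      (stabH2 basePoint).topologicalClosure) : X ∈ skewAdjointMatricesLieSubalgebra baseForm3 :=
    mem_skewAdjointMatricesLieSubalgebra_of_mem_lieSet
      (fun _ hg => transpose_mul_baseForm3_mul hg) hX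
  have hraise := hso (lieSet_mono (Subgroup.le_topologicalClosure _)
    (toLieSubalgebra_subset_lieSet_stabH2 (nilpositive_mem_toLieSubalgebra _)))
  have hodd := (pow_mem_skewAdjointMatricesLieSubalgebra_iff isUnit_baseForm3 hraise
    raise3_pow_two_ne_zero).1 (hso h)
  exact absurd hodd (by decide)

theorem idComp_stabH2_basePoint : idComp (stabH2 basePoint) =
    expGroup SpecialLinearGroup.coeMonoidHom (isSl2Triple_three.toLieSubalgebra ℝ : Set _) := by
  have hι := isClosedEmbedding_coeMonoidHom (n := Fin 3)
  let N : LieSubalgebra ℝ (Matrix (Fin 3) (Fin 3) ℝ) :=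
    lieSubalgebra SpecialLinearGroup.coeMonoidHom (stabH2 basePoint).topologicalClosure
      (hι.isClosedMap _ (Subgroup.isClosed_topologicalClosure _))
  have hle : isSl2Triple_three.toLieSubalgebra ℝ ≤ N := fun X hX =>
    lieSet_mono (Subgroup.le_topologicalClosure _) (toLieSubalgebra_subset_lieSet_stabH2 hX)
  refine idComp_eq_expGroup hι toLieSubalgebra_subset_lieSet_stabH2 fun X hX => ?_
  rcases eq_of_mem_three (N := N) (fun Y hY => mem_sl_of_mem_lieSet hY)
    (hle (nilpositive_mem_toLieSubalgebra _)) (hle (nilnegative_mem_toLieSubalgebra _)) with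
    hN | hN
  · exact hN.le hX
  · exact absurd (hN.ge (mem_sl_iff.2 (trace_pow_eq_zero isSl2Triple_three two_ne_zero)))
      raise3_pow_two_notMem_lieSet_stabH2

theorem idComp_stabH3_basePoint : idComp (stabH3 basePoint) =
    expGroup SpecialLinearGroup.coeMonoidHom
      (skewAdjointMatricesLieSubalgebra baseForm5 : Set _) := by
  refine idComp_eq_expGroup isClosedEmbedding_coeMonoidHom (fun X hX t => ?_)
    fun X hX => mem_skewAdjointMatricesLieSubalgebra_of_mem_lieSet
      (fun g hg => mem_stabH3_basePoint.1 hg) hX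
  have htX : t • X ∈ skewAdjointMatricesLieSubalgebra baseForm5 := Submodule.smul_mem _ t hX
  have htr := mem_sl_iff.1 (skewAdjointMatricesLieSubalgebra_le_sl isUnit_baseForm5 htX)
  exact ⟨⟨exp (t • X), det_exp_eq_one htr⟩,
    mem_stabH3_basePoint.2 (transpose_exp_mul_mul_exp htX), rfl⟩

end BasePointProjections

section Overgroups

open NormedSpace Topology LieAlgebra.SpecialLinear

attribute [local instance] Matrix.linftyOpNormedRing Matrix.linftyOpNormedAlgebra
attribute [local instance 100] LieRing.ofAssociativeRing

lemma idComp_le {G : Type*} [Group G] [TopologicalSpace G] [IsTopologicalGroup G]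
    (K : Subgroup G) : idComp K ≤ K :=
  Subgroup.map_subtype_le _

lemma subset_lieSet_expGroup {A G : Type*} [NormedRing A] [NormedAlgebra ℝ A] [Group G]
    {ι : G →* A} {K : Subgroup G} {L : Submodule ℝ A} (hL : (L : Set A) ⊆ lieSet ι K) :
    (L : Set A) ⊆ lieSet ι (expGroup ι (L : Set A)) := fun X hX t => by
  obtain ⟨g, -, hg⟩ := hL hX t
  exact ⟨g, mem_expGroup (L.smul_mem t hX) hg, hg⟩

lemma toLieSubalgebra_subset_lieSet_of_le {F : Subgroup HReal} (hF : idComp (stabH basePoint) ≤ F) :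
    (isSl2Triple_five_three.toLieSubalgebra ℝ : Set _) ⊆
      lieSet (pairHom (Fin 5) (Fin 3)) F := fun _ hX =>
  lieSet_mono (idComp_stabH_basePoint.ge.trans hF)
    (subset_lieSet_expGroup (L := (isSl2Triple_five_three.toLieSubalgebra ℝ).toSubmodule)
      toLieSubalgebra_subset_lieSet_stabH hX)

theorem eq_idComp_stabH_basePoint_or_eq_prod {F : Subgroup HReal}
    (hclosed : IsClosed (F : Set HReal)) (hconn : IsConnected (F : Set HReal))
    (hF : idComp (stabH basePoint) ≤ F) :
    F = idComp (stabH basePoint) ∨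
      ∃ K₁ ∈ ({idComp (stabH1 basePoint), idComp (stabH3 basePoint), ⊤} : Set (Subgroup _)),
        ∃ K₂ ∈ ({idComp (stabH2 basePoint), ⊤} : Set (Subgroup _)), F = K₁.prod K₂ := by
  have hle := toLieSubalgebra_subset_lieSet_of_le hF
  let N : LieSubalgebra ℝ (Matrix (Fin 5) (Fin 5) ℝ × Matrix (Fin 3) (Fin 3) ℝ) :=
    lieSubalgebra (pairHom (Fin 5) (Fin 3)) F (isClosedEmbedding_pairHom.isClosedMap _ hclosed)
  have hFN : F = expGroup (pairHom (Fin 5) (Fin 3)) (N.toSubmodule : Set _) :=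
    eq_expGroup_of_isConnected isClosedEmbedding_pairHom hclosed hconn
  rw [idComp_stabH_basePoint, idComp_stabH1_basePoint, idComp_stabH2_basePoint,
    idComp_stabH3_basePoint, ← expGroup_sl, ← expGroup_sl]
  rcases eq_of_mem_five_three (N := N) (fun _ hX => fst_mem_sl_and_snd_mem_sl hX)
    (hle (nilpositive_mem_toLieSubalgebra _)) (hle (nilnegative_mem_toLieSubalgebra _)) with
    hN | ⟨N₁, hN₁, N₂, hN₂, hN⟩
  · exact .inl (hN ▸ hFN)
  · rw [hN] at hFN
    have hprod := hFN.trans (expGroup_prod _ _ N₁.toSubmodule N₂.toSubmodule)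
    refine .inr ⟨_, ?_, _, ?_, hprod⟩
    · rcases hN₁ with rfl | rfl | rfl
      exacts [.inl rfl, .inr (.inl rfl), .inr (.inr rfl)]
    · rcases hN₂ with rfl | rfl
      exacts [.inl rfl, .inr rfl]

end Overgroups

section Signature

variable {n k : Type*} [Fintype n] [Fintype k] [DecidableEq k] {J : Matrix n n ℝ}
  {U : Matrix n k ℝ}

-- If the determinant vanished, `g` would move a nonzero vector of the negative definite column
-- space of `U` into its orthogonal complement, on which `J` is nonnegative.
lemma det_transpose_mul_mul_mul_ne_zero (hneg : ∀ a, a ≠ 0 → (U *ᵥ a) ⬝ᵥ J *ᵥ (U *ᵥ a) < 0)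
    (hnonneg : ∀ y, Uᵀ *ᵥ (J *ᵥ y) = 0 → 0 ≤ y ⬝ᵥ J *ᵥ y) {g : Matrix n n ℝ}
    (hg : gᵀ * J * g = J) : (Uᵀ * J * g * U).det ≠ 0 := fun hdet => by
  obtain ⟨a, ha, haU⟩ := exists_mulVec_eq_zero_iff.2 hdet
  have hisometry (v : n → ℝ) : (g *ᵥ v) ⬝ᵥ J *ᵥ (g *ᵥ v) = v ⬝ᵥ J *ᵥ v := by
    rw [← vecMul_transpose g, ← dotProduct_mulVec, vecMul_transpose, mulVec_mulVec, mulVec_mulVec,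
      hg]
  refine (hneg a ha).not_ge (hisometry (U *ᵥ a) ▸ hnonneg (g *ᵥ (U *ᵥ a)) ?_)
  simpa only [mulVec_mulVec, ← Matrix.mul_assoc] using haU

lemma det_mul_det_pos_of_mem_idComp [DecidableEq n]
    (hneg : ∀ a, a ≠ 0 → (U *ᵥ a) ⬝ᵥ J *ᵥ (U *ᵥ a) < 0)
    (hnonneg : ∀ y, Uᵀ *ᵥ (J *ᵥ y) = 0 → 0 ≤ y ⬝ᵥ J *ᵥ y)
    {K : Subgroup (SpecialLinearGroup n ℝ)} (hK : ∀ g ∈ K, g.1ᵀ * J * g.1 = J)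
    {g : SpecialLinearGroup n ℝ} (hg : g ∈ idComp K) :
    0 < (Uᵀ * J * U).det * (Uᵀ * J * g.1 * U).det := by
  obtain ⟨g, hg, rfl⟩ := hg
  let f (h : K) : ℝ := (Uᵀ * J * U).det * (Uᵀ * J * h.1.1 * U).det
  have hcont : Continuous f := by
    have hval : Continuous fun h : K => h.1.1 := continuous_subtype_val.comp continuous_subtype_val
    exact continuous_const.mul
      ((continuous_const.matrix_mul hval).matrix_mul continuous_const).matrix_det
  have hone : (Uᵀ * J * U).det ≠ 0 := by
    simpa using det_transpose_mul_mul_mul_ne_zero hneg hnonneg (hK 1 K.one_mem)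
  have hf1 : 0 < f 1 := by
    simpa [f] using hone
  by_contra! hle
  obtain ⟨z, -, hz⟩ := (isPreconnected_connectedComponent (x := (1 : K))).intermediate_value hg
    mem_connectedComponent hcont.continuousOn ⟨hle, hf1.le⟩
  exact mul_ne_zero hone (det_transpose_mul_mul_mul_ne_zero hneg hnonneg (hK z z.2)) hz

end Signature

section ConnectedOvergroups

/-- The element of the stabilizer of the base point with which one detects that the stabilizer is
not connected. -/
def signElement : HReal :=
  (⟨diagonal ![1, -1, 1, -1, 1], by simp [det_diagonal, Fin.prod_univ_five]⟩,
    ⟨diagonal ![-1, 1, -1], by simp [det_diagonal, Fin.prod_univ_three]⟩)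

lemma signElement_mem_stabH : signElement ∈ stabH basePoint := by
  rw [mem_stabH_iff_tensorAct_eq]
  have hpair : pairHom (Fin 5) (Fin 3) signElement =
      (diagonal ![1, -1, 1, -1, 1], diagonal ![-1, 1, -1]) := rfl
  ext k i j
  rw [tensorAct_apply, hpair]
  fin_cases k <;> fin_cases i <;> fin_cases j <;>
    simp [basePoint_zero, basePoint_one, basePoint_two, Fin.sum_univ_three]

/-- A basis, as columns, of a maximal negative definite subspace for `baseForm5`. -/
def negativePlane : Matrix (Fin 5) (Fin 2) ℝ := !![1, 0; 0, 1; 0, 0; 0, 1; -1, 0]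

lemma negativePlane_neg (a : Fin 2 → ℝ) (ha : a ≠ 0) :
    (negativePlane *ᵥ a) ⬝ᵥ baseForm5 *ᵥ (negativePlane *ᵥ a) < 0 := by
  have hsq : 0 < a 0 ^ 2 + a 1 ^ 2 := by
    simpa [dotProduct, Fin.sum_univ_two, sq] using dotProduct_star_self_pos_iff.2 ha
  have hval : (negativePlane *ᵥ a) ⬝ᵥ baseForm5 *ᵥ (negativePlane *ᵥ a) =
      -72 * a 0 ^ 2 - 18 * a 1 ^ 2 := by
    simp [negativePlane, baseForm5, dotProduct, mulVec, Fin.sum_univ_five]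
    ring
  nlinarith [sq_nonneg (a 0)]

lemma baseForm5_nonneg_of_orthogonal (y : Fin 5 → ℝ)
    (hy : negativePlaneᵀ *ᵥ (baseForm5 *ᵥ y) = 0) : 0 ≤ y ⬝ᵥ baseForm5 *ᵥ y := by
  have h4 : y 4 = y 0 := by
    have := congrFun hy 0
    simp [negativePlane, baseForm5, dotProduct, mulVec, Fin.sum_univ_five] at this
    linarith
  have h3 : y 3 = -y 1 := by
    have := congrFun hy 1
    simp [negativePlane, baseForm5, dotProduct, mulVec, Fin.sum_univ_five] at this
    linarith
  have hval : y ⬝ᵥ baseForm5 *ᵥ y = 72 * y 0 ^ 2 + 18 * y 1 ^ 2 + 6 * y 2 ^ 2 := by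
    simp [baseForm5, dotProduct, mulVec, Fin.sum_univ_five, h3, h4]
    ring
  rw [hval]
  positivity

lemma signElement_fst_notMem_idComp_stabH3 :
    signElement.1 ∉ idComp (stabH3 basePoint) := fun h => by
  have hpos := det_mul_det_pos_of_mem_idComp negativePlane_neg baseForm5_nonneg_of_orthogonal
    (fun _ => mem_stabH3_basePoint.1) h
  have hone : negativePlaneᵀ * baseForm5 * negativePlane = !![-72, 0; 0, -18] := by
    simp [negativePlane, baseForm5, ← Matrix.ext_iff, Fin.forall_fin_succ, mul_apply,
      Fin.sum_univ_five]
    norm_num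
  have hsign : negativePlaneᵀ * baseForm5 * signElement.1.1 * negativePlane =
      !![-72, 0; 0, 18] := by
    simp [negativePlane, baseForm5, signElement, ← Matrix.ext_iff, Fin.forall_fin_succ, mul_apply,
      Fin.sum_univ_five]
    norm_num
  rw [hone, hsign] at hpos
  norm_num [det_fin_two] at hpos

theorem eq_stabH_basePoint_or_eq_prod {F : Subgroup HReal}
    (hclosed : IsClosed (F : Set HReal)) (hconn : IsConnected (F : Set HReal))
    (hF : stabH basePoint ≤ F) :
    F = stabH basePoint ∨ ∃ K₁ ∈ ({stabH1 basePoint, ⊤} : Set (Subgroup _)),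
      ∃ K₂ ∈ ({stabH2 basePoint, ⊤} : Set (Subgroup _)), F = K₁.prod K₂ := by
  rcases eq_idComp_stabH_basePoint_or_eq_prod hclosed hconn ((idComp_le _).trans hF) with
    h | ⟨K₁, hK₁, K₂, hK₂, rfl⟩
  · exact .inl (le_antisymm (h.le.trans (idComp_le _)) hF)
  have hle₁ : stabH1 basePoint ≤ K₁ := Subgroup.map_le_iff_le_comap.2 fun g hg => (hF hg).1
  have hle₂ : stabH2 basePoint ≤ K₂ := Subgroup.map_le_iff_le_comap.2 fun g hg => (hF hg).2
  refine .inr ⟨K₁, ?_, K₂, ?_, rfl⟩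
  · rcases hK₁ with rfl | rfl | rfl
    · exact .inl ((idComp_le _).antisymm hle₁)
    · exact absurd (hF signElement_mem_stabH).1 signElement_fst_notMem_idComp_stabH3
    · exact .inr rfl
  · rcases hK₂ with rfl | rfl
    · exact .inl ((idComp_le _).antisymm hle₂)
    · exact .inr rfl

end ConnectedOvergroups

section Transport

lemma coe_idComp {G : Type*} [Group G] [TopologicalSpace G] [IsTopologicalGroup G]
    (K : Subgroup G) : (idComp K : Set G) = connectedComponentIn K 1 :=
  (connectedComponentIn_eq_image K.one_mem).symm

lemma idComp_mapSubgroup {A B : Type*} [Group A] [TopologicalSpace A] [IsTopologicalGroup A]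
    [Group B] [TopologicalSpace B] [IsTopologicalGroup B] (e : A ≃ₜ* B) (K : Subgroup A) :
    idComp (e.toMulEquiv.mapSubgroup K) = e.toMulEquiv.mapSubgroup (idComp K) := by
  have himage := e.toHomeomorph.image_connectedComponentIn K.one_mem
  rw [← coe_idComp, show e.toHomeomorph 1 = 1 from map_one e] at himage
  exact SetLike.coe_injective ((coe_idComp _).trans himage.symm)

lemma isClosed_mapSubgroup_iff {A B : Type*} [Group A] [TopologicalSpace A] [Group B]
    [TopologicalSpace B] (e : A ≃ₜ* B) {K : Subgroup A} :
    IsClosed (e.toMulEquiv.mapSubgroup K : Set B) ↔ IsClosed (K : Set A) :=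
  e.toHomeomorph.isClosed_image

lemma isConnected_mapSubgroup_iff {A B : Type*} [Group A] [TopologicalSpace A] [Group B]
    [TopologicalSpace B] (e : A ≃ₜ* B) {K : Subgroup A} :
    IsConnected (e.toMulEquiv.mapSubgroup K : Set B) ↔ IsConnected (K : Set A) :=
  e.toHomeomorph.isConnected_image

variable {n : Type*} [Fintype n] [DecidableEq n]

/-- Conjugation by an element of `GL n ℝ` as an automorphism of the topological group `SL n ℝ`; it
relates the stabilizers of two points of a `GReal`-orbit. -/
def conjSL (g : GL n ℝ) : SpecialLinearGroup n ℝ ≃ₜ* SpecialLinearGroup n ℝ where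
  toFun A := ⟨g * A.1 * g⁻¹, by rw [det_mul_right_comm, Units.mul_inv, one_mul, A.2]⟩
  invFun A := ⟨g⁻¹ * A.1 * g, by rw [det_mul_right_comm, Units.inv_mul, one_mul, A.2]⟩
  left_inv A := Subtype.ext (by simp [← Matrix.mul_assoc])
  right_inv A := Subtype.ext (by simp [← Matrix.mul_assoc])
  map_mul' A B := Subtype.ext (by
    change g * (A.1 * B.1) * g⁻¹ = g * A.1 * g⁻¹ * (g * B.1 * g⁻¹)
    simp [Matrix.mul_assoc])
  continuous_toFun := by
    refine Continuous.subtype_mk ?_ _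
    exact (continuous_const.matrix_mul continuous_subtype_val).matrix_mul continuous_const
  continuous_invFun := by
    refine Continuous.subtype_mk ?_ _
    exact (continuous_const.matrix_mul continuous_subtype_val).matrix_mul continuous_const

lemma coe_conjSL (g : GL n ℝ) (A : SpecialLinearGroup n ℝ) :
    (conjSL g A).1 = (g : Matrix n n ℝ) * A.1 * (g⁻¹ : GL n ℝ) := rfl

/-- Conjugation by an element of `GReal`, as an automorphism of the topological group `HReal`. -/
def conjH (g : GReal) : HReal ≃ₜ* HReal where
  toMulEquiv := (conjSL g.1).toMulEquiv.prodCongr (conjSL g.2).toMulEquiv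
  continuous_toFun := (conjSL g.1).continuous.prodMap (conjSL g.2).continuous
  continuous_invFun := (conjSL g.1).symm.continuous.prodMap (conjSL g.2).symm.continuous

lemma inclHG_conjH (g : GReal) (h : HReal) : inclHG (conjH g h) = g * inclHG h * g⁻¹ :=
  Prod.ext (Units.ext rfl) (Units.ext rfl)

lemma mapSubgroup_conjH_prod (g : GReal) (K₁ : Subgroup (SpecialLinearGroup (Fin 5) ℝ))
    (K₂ : Subgroup (SpecialLinearGroup (Fin 3) ℝ)) :
    (conjH g).toMulEquiv.mapSubgroup (K₁.prod K₂) =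
      ((conjSL g.1).toMulEquiv.mapSubgroup K₁).prod ((conjSL g.2).toMulEquiv.mapSubgroup K₂) :=
  SetLike.coe_injective (Set.prodMap_image_prod (conjSL g.1) (conjSL g.2) _ _)

lemma stabH_smul (g : GReal) (x : altTensor) :
    stabH (g • x) = (conjH g).toMulEquiv.mapSubgroup (stabH x) := by
  ext h
  obtain ⟨h, rfl⟩ := (conjH g).surjective h
  refine Iff.trans ?_ (Subgroup.mem_map_iff_mem (conjH g).injective).symm
  rw [mem_stabH, mem_stabH, inclHG_conjH, smul_smul, inv_mul_cancel_right, mul_smul,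
    smul_left_cancel_iff]

lemma stabH1_smul (g : GReal) (x : altTensor) :
    stabH1 (g • x) = (conjSL g.1).toMulEquiv.mapSubgroup (stabH1 x) := by
  simp only [stabH1, stabH_smul, MulEquiv.mapSubgroup_apply, Subgroup.map_map]
  rfl

lemma stabH2_smul (g : GReal) (x : altTensor) :
    stabH2 (g • x) = (conjSL g.2).toMulEquiv.mapSubgroup (stabH2 x) := by
  simp only [stabH2, stabH_smul, MulEquiv.mapSubgroup_apply, Subgroup.map_map]
  rfl

lemma stabH3_smul (g : GReal) (x : altTensor) :
    stabH3 (g • x) = (conjSL g.1).toMulEquiv.mapSubgroup (stabH3 x) := by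
  obtain ⟨c, hc, hPhi2⟩ := exists_Phi2_smul g x
  ext h
  obtain ⟨h, rfl⟩ := (conjSL g.1).surjective h
  refine Iff.trans ?_ (Subgroup.mem_map_iff_mem (conjSL g.1).injective).symm
  have hconj (b : Fin 5 → ℝ) :
      Phi2 (g • x) ((conjSL g.1 h).1 *ᵥ (g.1.1 *ᵥ b)) = c * Phi2 x (h.1 *ᵥ b) := by
    rw [← hPhi2, coe_conjSL, mulVec_mulVec, mulVec_mulVec, Units.inv_mul_cancel_right]
  have hsurj : Function.Surjective (g.1.1 *ᵥ ·) := fun a => ⟨g.1.2 *ᵥ a, by simp⟩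
  refine hsurj.forall.trans (forall_congr' fun b => ?_)
  rw [hconj, hPhi2, mul_right_inj' hc]

theorem eq_idComp_stabH_or_eq_prod {x : altTensor} (hx : x ∈ MulAction.orbit GReal basePoint)
    {F : Subgroup HReal} (hclosed : IsClosed (F : Set HReal)) (hconn : IsConnected (F : Set HReal))
    (hF : idComp (stabH x) ≤ F) :
    F = idComp (stabH x) ∨
      ∃ K₁ ∈ ({idComp (stabH1 x), idComp (stabH3 x), ⊤} : Set (Subgroup _)),
        ∃ K₂ ∈ ({idComp (stabH2 x), ⊤} : Set (Subgroup _)), F = K₁.prod K₂ := by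
  obtain ⟨g, rfl⟩ := hx
  obtain ⟨F, rfl⟩ := (conjH g).toMulEquiv.mapSubgroup.surjective F
  simp only [stabH_smul, stabH1_smul, stabH2_smul, stabH3_smul, idComp_mapSubgroup,
    OrderIso.le_iff_le] at hF ⊢
  rcases eq_idComp_stabH_basePoint_or_eq_prod ((isClosed_mapSubgroup_iff _).1 hclosed)
    ((isConnected_mapSubgroup_iff _).1 hconn) hF with rfl | ⟨K₁, hK₁, K₂, hK₂, rfl⟩
  · exact .inl rfl
  · refine .inr ⟨_, ?_, _, ?_, mapSubgroup_conjH_prod g K₁ K₂⟩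
    · rcases hK₁ with rfl | rfl | rfl <;> simp
    · rcases hK₂ with rfl | rfl <;> simp

theorem eq_stabH_or_eq_prod {x : altTensor} (hx : x ∈ MulAction.orbit GReal basePoint)
    {F : Subgroup HReal} (hclosed : IsClosed (F : Set HReal)) (hconn : IsConnected (F : Set HReal))
    (hF : stabH x ≤ F) :
    F = stabH x ∨ ∃ K₁ ∈ ({stabH1 x, ⊤} : Set (Subgroup _)),
      ∃ K₂ ∈ ({stabH2 x, ⊤} : Set (Subgroup _)), F = K₁.prod K₂ := by
  obtain ⟨g, rfl⟩ := hx
  obtain ⟨F, rfl⟩ := (conjH g).toMulEquiv.mapSubgroup.surjective F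
  simp only [stabH_smul, stabH1_smul, stabH2_smul, OrderIso.le_iff_le] at hF ⊢
  rcases eq_stabH_basePoint_or_eq_prod ((isClosed_mapSubgroup_iff _).1 hclosed)
    ((isConnected_mapSubgroup_iff _).1 hconn) hF with rfl | ⟨K₁, hK₁, K₂, hK₂, rfl⟩
  · exact .inl rfl
  · refine .inr ⟨_, ?_, _, ?_, mapSubgroup_conjH_prod g K₁ K₂⟩
    · rcases hK₁ with rfl | rfl <;> simp
    · rcases hK₂ with rfl | rfl <;> simp

end Transport

theorem mainTheorem3 (x : altTensor) (hx : x ∈ MulAction.orbit GReal basePoint) :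
    (∀ F : Subgroup HReal, IsClosed (F : Set HReal) → IsConnected (F : Set HReal) →
      idComp (stabH x) ≤ F →
        F = idComp (stabH x) ∨
        F = (idComp (stabH1 x)).prod (idComp (stabH2 x)) ∨
        F = (idComp (stabH1 x)).prod ⊤ ∨
        F = (idComp (stabH3 x)).prod (idComp (stabH2 x)) ∨
        F = (idComp (stabH3 x)).prod ⊤ ∨
        F = (⊤ : Subgroup (Matrix.SpecialLinearGroup (Fin 5) ℝ)).prod (idComp (stabH2 x)) ∨
        F = (⊤ : Subgroup (Matrix.SpecialLinearGroup (Fin 5) ℝ)).prod ⊤) ∧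
    (∀ F : Subgroup HReal, IsClosed (F : Set HReal) → IsConnected (F : Set HReal) →
      stabH x ≤ F →
        F = stabH x ∨
        F = (stabH1 x).prod (stabH2 x) ∨
        F = (stabH1 x).prod ⊤ ∨
        F = (stabH3 x).prod (stabH2 x) ∨
        F = (stabH3 x).prod ⊤ ∨
        F = (⊤ : Subgroup (Matrix.SpecialLinearGroup (Fin 5) ℝ)).prod (stabH2 x) ∨
        F = (⊤ : Subgroup (Matrix.SpecialLinearGroup (Fin 5) ℝ)).prod ⊤) := by
  refine ⟨fun F hclosed hconn hF => ?_, fun F hclosed hconn hF => ?_⟩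
  · simpa only [Set.mem_insert_iff, Set.mem_singleton_iff, exists_eq_or_imp, exists_eq_left,
      or_assoc] using eq_idComp_stabH_or_eq_prod hx hclosed hconn hF
  · have hcases := eq_stabH_or_eq_prod hx hclosed hconn hF
    simp only [Set.mem_insert_iff, Set.mem_singleton_iff, exists_eq_or_imp, exists_eq_left]
      at hcases
    tauto
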